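/- Let $K=\mathbf Q[q,q^{-1}]$ be the ring of Laurent polynomials over $\mathbf Q$, and let $n\ge 2$. For $m\ge 2$, let $H\tilde C_m(q)$ be the Hecke algebra of type $\tilde C_m$ over $K$ with parameter $q$: the associative unital $K$-algebra with generators $g_{\sigma_0},\dots,g_{\sigma_{m-1}},g_{t_m}$, one for each vertex of the Coxeter diagram of type $\tilde C_m$ (a path $\sigma_0,\sigma_1,\dots,\sigma_{m-1},t_m$ whose two extreme edges have label $4$ and whose other edges have label $3$), subject to the relations - $g_s^2=q+(q-1)g_s$ for every vertex $s$; - $g_sg_u=g_ug_s$ for distinct non-adjacent vertices $s,u$; - $g_sg_ug_s=g_ug_sg_u$ for vertices $s,u$ joined by an edge with label $3$; - $g_sg_ug_sg_u=g_ug_sg_ug_s$ for vertices $s,u$ joined by an edge with label $4$. Every generator is then invertible. Write $e$ instead of $g$ for the generators of $H\tilde C_n(q)$. There is a unique homomorphism of unital $K$-algebras $$R_n: H\tilde C_n(q)\longrightarrow H\tilde C_{n+1}(q),\qquad e_{\sigma_i}\longmapsto g_{\sigma_i}\ (0\le i\le n-1),\qquad e_{t_n}\longmapsto g_{\sigma_n}\,g_{t_{n+1}}\,g_{\sigma_n}^{-1},$$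 and it is injective. -/

import Mathlib

open scoped LaurentPolynomial

noncomputable section

/-! ### Hecke algebras of Coxeter matrices -/

section Hecke

variable {B : Type*} (M : CoxeterMatrix B) {K : Type*} [CommRing K] (q : K)

/-- The alternating product `x y x y ⋯` with `m` factors, beginning with `x`: it is `(x y) ^ r` if
`m = 2 r` and `(x y) ^ r x` if `m = 2 r + 1`. -/
def altProd {A : Type*} [Monoid A] (x y : A) (m : ℕ) : A :=
  (x * y) ^ (m / 2) * (if Even m then 1 else x)

/-- The defining relations of the Hecke algebra with parameter `q` of the Coxeter matrix `M`:
the quadratic relations `g_s ^ 2 = q + (q - 1) g_s`, and the braid relations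
`g_s g_t g_s ⋯ = g_t g_s g_t ⋯` with `M s t` factors on each side, whenever `M s t` is finite
(the value `0` of a Coxeter matrix stands for `∞`). -/
inductive HeckeRel : FreeAlgebra K B → FreeAlgebra K B → Prop
  | quadratic (s : B) :
      HeckeRel (FreeAlgebra.ι K s ^ 2)
        (algebraMap K (FreeAlgebra K B) q + (q - 1) • FreeAlgebra.ι K s)
  | braid (s t : B) (h : M s t ≠ 0) :
      HeckeRel (altProd (FreeAlgebra.ι K s) (FreeAlgebra.ι K t) (M s t))
        (altProd (FreeAlgebra.ι K t) (FreeAlgebra.ι K s) (M s t))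

/-- The Hecke algebra over `K` with parameter `q` of the Coxeter matrix `M`: the associative unital
`K`-algebra generated by the `g_s`, `s : B`, subject to the relations `HeckeRel`. -/
abbrev HeckeAlgebra : Type _ := RingQuot (HeckeRel M q)

/-- The generator `g_s` of the Hecke algebra. -/
def heckeGen (s : B) : HeckeAlgebra M q :=
  RingQuot.mkAlgHom K (HeckeRel M q) (FreeAlgebra.ι K s)

theorem heckeGen_sq (s : B) :
    heckeGen M q s ^ 2 = algebraMap K (HeckeAlgebra M q) q + (q - 1) • heckeGen M q s := by
  have h := RingQuot.mkAlgHom_rel K (HeckeRel.quadratic (M := M) (q := q) s)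
  simpa [heckeGen] using h

/-- When the parameter is invertible, `g_s` is a unit, with inverse `q⁻¹ (g_s - (q - 1))`. -/
def heckeUnit (q : Kˣ) (s : B) : (HeckeAlgebra M (q : K))ˣ where
  val := heckeGen M (q : K) s
  inv := (↑q⁻¹ : K) • (heckeGen M (q : K) s - algebraMap K _ ((q : K) - 1))
  val_inv := by
    rw [mul_smul_comm, mul_sub, ← pow_two, heckeGen_sq, ← Algebra.commutes, ← Algebra.smul_def,
      add_sub_cancel_right, Algebra.algebraMap_eq_smul_one, smul_smul, Units.inv_mul, one_smul]
  inv_val := by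
    rw [smul_mul_assoc, sub_mul, ← pow_two, heckeGen_sq, ← Algebra.smul_def,
      add_sub_cancel_right, Algebra.algebraMap_eq_smul_one, smul_smul, Units.inv_mul, one_smul]

end Hecke

/-! ### The affine type `C` -/

/-- The Coxeter matrix of type `C̃ₙ`, for `n ≥ 2`. Its diagram is the path `0 - 1 - ⋯ - n` whose two
extreme edges `{0, 1}` and `{n - 1, n}` are labelled `4` and whose other edges are labelled `3`.
The vertex `i < n` is the generator `σ_i` and the vertex `n` is the generator `t_n`. -/
def coxeterMatrixCTilde (n : ℕ) : CoxeterMatrix (Fin (n + 1)) where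
  M := Matrix.of fun i j : Fin (n + 1) ↦
    if i = j then 1
    else if (i : ℕ) + 1 = j ∨ (j : ℕ) + 1 = i then
      (if (i : ℕ) = 0 ∨ (j : ℕ) = 0 ∨ (i : ℕ) = n ∨ (j : ℕ) = n then 4 else 3)
    else 2
  isSymm := by
    ext i j
    simp only [Matrix.transpose_apply, Matrix.of_apply]
    grind
  diagonal := by simp
  off_diagonal := by
    intro i j h
    simp only [Matrix.of_apply]
    grind

section CTilde

variable {K : Type*} [CommRing K] (q : Kˣ) (n : ℕ)

/-- The Hecke algebra of type `C̃ₙ` over `K`, with invertible parameter `q`. -/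
abbrev HeckeCTilde : Type _ := HeckeAlgebra (coxeterMatrixCTilde n) (q : K)

/-- The invertible generator `g_{σ_i}`, `0 ≤ i ≤ n - 1`, of the Hecke algebra of type `C̃ₙ`. -/
def gSigma (i : Fin n) : (HeckeCTilde q n)ˣ := heckeUnit (coxeterMatrixCTilde n) q i.castSucc

/-- The invertible generator `g_{t_n}` of the Hecke algebra of type `C̃ₙ`. -/
def gT : (HeckeCTilde q n)ˣ := heckeUnit (coxeterMatrixCTilde n) q (Fin.last n)

/-- The algebra map `R` sends `e_{σ_i}` to `g_{σ_i}` for `0 ≤ i ≤ n - 1`, and `e_{t_n}` to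
`g_{σ_n} g_{t_{n+1}} g_{σ_n}⁻¹`. -/
def IsTowerMap (R : HeckeCTilde q n →ₐ[K] HeckeCTilde q (n + 1)) : Prop :=
  (∀ i : Fin n, R (gSigma q n i) = gSigma q (n + 1) i.castSucc) ∧
    R (gT q n) =
      gSigma q (n + 1) (Fin.last n) * gT q (n + 1) * ↑(gSigma q (n + 1) (Fin.last n))⁻¹

end CTilde

/-- The indeterminate `q` of the Laurent polynomial ring `ℚ[q, q⁻¹]`, as a unit. -/
def laurentQ : ℚ[T;T⁻¹]ˣ where
  val := LaurentPolynomial.T 1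
  inv := LaurentPolynomial.T (-1)
  val_inv := by rw [← LaurentPolynomial.T_add]; simp
  inv_val := by rw [← LaurentPolynomial.T_add]; simp

end

noncomputable section

/-! Uniqueness is clear, since the generators generate. For existence, the only delicate relation is
the one of length 4 between `σ_{n-1}` and the image of `t_n`: conjugation by `g_{σ_n} g_{σ_{n-1}}`
carries the length 4 relation between `σ_n` and `t_{n+1}` to it (`altProd_conj_four`).

Injectivity is deduced from the case `q = 1`, that is, from the affine Weyl groups `W_n`. By
Matsumoto's theorem the elements `T_w`, `w ∈ W_n`, span the source (`span_basisElt`). The target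
acts on the free module on `W_{n+1}` (`regularRep`). Applying `R (T_w)` to the basis vector `1`
gives a vector which at `q = 1` becomes a single group element: the product of a reduced word of `w`
with `t_n` replaced by `σ_n t_{n+1} σ_n`. If these group elements are distinct, the vectors are
linearly independent, because a determinant that specializes to `1` is nonzero
(`linearIndependent_of_mapRange`). A linear map sending a spanning family to an independent one is
injective.

Distinctness is seen by realizing `W_n` as permutations of `ℤ`: the modified word acts on the image
of an injection `affEmb n : ℤ → ℤ` just as the original word acts on `ℤ`. The same model supplies
the descents and the exchange condition behind Matsumoto's theorem and the regular representation.
-/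

theorem altProd_zero {A : Type*} [Monoid A] (x y : A) : altProd x y 0 = 1 := by
  simp [altProd]

theorem altProd_succ {A : Type*} [Monoid A] (x y : A) (m : ℕ) :
    altProd x y (m + 1) = x * altProd y x m := by
  have key : ∀ r : ℕ, (x * y) ^ r * x = x * (y * x) ^ r := fun r ↦ by
    induction r with
    | zero => simp
    | succ r ih => rw [pow_succ', mul_assoc, ih, pow_succ']; simp only [mul_assoc]
  rcases Nat.even_or_odd m with h | h
  · obtain ⟨r, rfl⟩ := h
    have h1 : (r + r + 1) / 2 = r := by omega
    have h2 : (r + r) / 2 = r := by omega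
    have h3 : ¬ Even (r + r + 1) := by simp
    have h4 : Even (r + r) := by simp
    simp [altProd, h1, h2, h3, h4, key]
  · obtain ⟨r, rfl⟩ := h
    have h1 : (2 * r + 1 + 1) / 2 = r + 1 := by omega
    have h2 : (2 * r + 1) / 2 = r := by omega
    have h3 : ¬ Even (2 * r + 1) := by simp
    have h4 : Even (2 * r + 1 + 1) := by grind
    simp only [altProd, h1, h2, h3, h4, if_true, if_false, mul_one]
    rw [← mul_assoc, ← key r, pow_succ, mul_assoc]

theorem map_altProd {A A' F : Type*} [Monoid A] [Monoid A'] [FunLike F A A'] [MonoidHomClass F A A']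
    (f : F) (x y : A) (m : ℕ) : f (altProd x y m) = altProd (f x) (f y) m := by
  induction m generalizing x y with
  | zero => simp [altProd_zero]
  | succ m ih => simp [altProd_succ, ih]

/-- The alternating word `i j i j ⋯` with `k` letters. -/
def altList {B : Type*} (i j : B) : ℕ → List B
  | 0 => []
  | k + 1 => i :: altList j i k

theorem prod_map_altList {A B : Type*} [Monoid A] (f : B → A) (i j : B) (k : ℕ) :
    ((altList i j k).map f).prod = altProd (f i) (f j) k := by
  induction k generalizing i j with
  | zero => simp [altList, altProd_zero]
  | succ k ih => simp [altList, altProd_succ, ih]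

theorem length_altList {B : Type*} (i j : B) (k : ℕ) : (altList i j k).length = k := by
  induction k generalizing i j with
  | zero => rfl
  | succ k ih => simp [altList, ih]

theorem exists_altList_succ {B : Type*} (i j : B) (k : ℕ) :
    ∃ x, altList i j (k + 1) = altList i j k ++ [x] := by
  induction k generalizing i j with
  | zero => exact ⟨i, rfl⟩
  | succ k ih =>
    obtain ⟨x, hx⟩ := ih j i
    exact ⟨x, by rw [altList, hx]; rfl⟩

/-! ### Exchange condition, word length and Matsumoto's theorem. -/

/-- A group `G` generated by involutions `s i`, with predicates `N i` satisfying the conditions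
which make `N i w` equivalent to `s i` being a left descent of `w`. -/
structure ExchangeSystem {G B : Type*} [Group G] (s : B → G) (N : B → G → Prop) : Prop where
  mul_self : ∀ i, s i * s i = 1
  exists_word : ∀ w, ∃ L : List B, (L.map s).prod = w
  not_one : ∀ i, ¬ N i 1
  mul_iff : ∀ i w, N i (s i * w) ↔ ¬ N i w
  exchange : ∀ i j w, ¬ (N i w ↔ N i (w * s j)) → s i * w = w * s j

/-- The elements `s i` satisfy the braid relations of `M`, all of whose entries are finite, and no
shorter ones. -/
structure HasBraidOrders {G B : Type*} [Group G] (s : B → G) (M : CoxeterMatrix B) : Prop where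
  ne_zero : ∀ i j, M i j ≠ 0
  braid : ∀ i j, altProd (s i) (s j) (M i j) = altProd (s j) (s i) (M i j)
  ne_of_lt : ∀ i j k, 0 < k → k < M i j → altProd (s i) (s j) k ≠ altProd (s j) (s i) k

/-- The word length with respect to the family `s`. -/
def wordLength {G B : Type*} [Group G] (s : B → G) (w : G) : ℕ :=
  sInf {k | ∃ L : List B, (L.map s).prod = w ∧ L.length = k}

theorem wordLength_le {G B : Type*} [Group G] (s : B → G) (L : List B) :
    wordLength s (L.map s).prod ≤ L.length :=
  Nat.sInf_le ⟨L, rfl, rfl⟩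

namespace ExchangeSystem

variable {G B : Type*} [Group G] {s : B → G} {N : B → G → Prop}

theorem inv_eq (h : ExchangeSystem s N)
    (i : B) : (s i)⁻¹ = s i := inv_eq_of_mul_eq_one_left (h.mul_self i)

theorem mul_cancel (h : ExchangeSystem s N) (i : B) (w : G) : s i * (s i * w) = w := by
  rw [← mul_assoc, h.mul_self, one_mul]

theorem exists_reduced (h : ExchangeSystem s N)
    (w : G) : ∃ L : List B, (L.map s).prod = w ∧ L.length = wordLength s w :=
  Nat.sInf_mem (s := {k | ∃ L : List B, (L.map s).prod = w ∧ L.length = k})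
    (let ⟨L, hL⟩ := h.exists_word w; ⟨L.length, L, hL, rfl⟩)

theorem wordLength_mul_le (h : ExchangeSystem s N)
    (i : B) (w : G) : wordLength s (s i * w) ≤ wordLength s w + 1 := by
  obtain ⟨L, rfl, hL⟩ := h.exists_reduced w
  rw [← hL]
  exact wordLength_le s (i :: L)

theorem wordLength_inv (h : ExchangeSystem s N) (w : G) : wordLength s w⁻¹ = wordLength s w := by
  have key : ∀ w : G, wordLength s w⁻¹ ≤ wordLength s w := fun w ↦ by
    obtain ⟨L, rfl, hL⟩ := h.exists_reduced w
    have e : (L.map s).prod⁻¹ = (L.reverse.map s).prod := by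
      rw [List.prod_inv_reverse, List.map_map, List.map_reverse]
      congr 2
      exact List.map_congr_left fun i _ ↦ h.inv_eq i
    rw [e, ← hL, ← List.length_reverse]
    exact wordLength_le s _
  exact le_antisymm (key w) (by simpa using key w⁻¹)

/-- Along the prefixes of the word, `N i` passes from false to true at some letter. There `exchange`
moves `s i` through the prefix, where it cancels that letter. -/
theorem exists_deletion (h : ExchangeSystem s N)
    {i : B} {p : G} {L : List B} (hp : ¬ N i p) (hL : N i (p * (L.map s).prod)) :
    ∃ L' : List B, L'.length + 1 = L.length ∧ s i * (p * (L.map s).prod) = p * (L'.map s).prod := by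
  induction L generalizing p with
  | nil => simp [hp] at hL
  | cons x L ih =>
    by_cases hx : N i (p * s x)
    · have e := h.exchange i x p (by tauto)
      refine ⟨L, rfl, ?_⟩
      rw [← mul_assoc, e, List.map_cons, List.prod_cons, mul_assoc, h.mul_cancel]
    · obtain ⟨L', h1, h2⟩ := ih hx (by simpa [mul_assoc] using hL)
      exact ⟨x :: L', by simp [h1], by simpa [mul_assoc] using h2⟩

theorem wordLength_of_neg (h : ExchangeSystem s N) {i : B} {w : G} (hw : N i w) :
    wordLength s (s i * w) + 1 = wordLength s w := by
  obtain ⟨L, rfl, hL⟩ := h.exists_reduced w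
  obtain ⟨L', h1, h2⟩ := h.exists_deletion (h.not_one i) (by simpa using hw)
  rw [one_mul, one_mul] at h2
  have h3 := wordLength_le s L'
  have h4 := h.wordLength_mul_le i (s i * (L.map s).prod)
  rw [h.mul_cancel] at h4
  rw [← h2] at h3
  omega

theorem wordLength_of_not_neg (h : ExchangeSystem s N) {i : B} {w : G} (hw : ¬ N i w) :
    wordLength s (s i * w) = wordLength s w + 1 := by
  have := h.wordLength_of_neg ((h.mul_iff i w).2 hw)
  rw [h.mul_cancel] at this
  exact this.symm

theorem neg_iff_lt (h : ExchangeSystem s N)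
    (i : B) (w : G) : N i w ↔ wordLength s (s i * w) < wordLength s w := by
  by_cases hw : N i w
  · have := h.wordLength_of_neg hw
    simp only [hw, true_iff]; omega
  · have := h.wordLength_of_not_neg hw
    simp only [hw, false_iff]; omega

/-- Descents are detected by length, which is invariant under inversion, and here left and right
multiplication give the same element. -/
theorem neg_iff_neg_inv (h : ExchangeSystem s N)
    {i j : B} {w : G} (e : s i * w = w * s j) : N i w ↔ N j w⁻¹ := by
  rw [h.neg_iff_lt, h.neg_iff_lt, h.wordLength_inv, e, ← h.wordLength_inv (w * s j), mul_inv_rev,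
    h.inv_eq]

/-- At the first length where `i` became a descent, `exchange` would produce a braid relation
shorter than `m`. -/
theorem not_neg_altProd (h : ExchangeSystem s N) {i j : B} {m : ℕ}
    (hm : ∀ k, 0 < k → k < m → altProd (s i) (s j) k ≠ altProd (s j) (s i) k) {k : ℕ} (hk : k < m) :
    ¬ N i (altProd (s j) (s i) k) := by
  induction k with
  | zero => simpa [altProd_zero] using h.not_one i
  | succ k ih =>
    intro hN
    obtain ⟨x, hx⟩ := exists_altList_succ j i k
    have hx' : altProd (s j) (s i) (k + 1) = altProd (s j) (s i) k * s x := by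
      rw [← prod_map_altList, hx, List.map_append, List.prod_append, prod_map_altList]; simp
    have e := h.exchange i x (altProd (s j) (s i) k) (by rw [← hx']; have := ih (by omega); tauto)
    refine hm (k + 1) (by omega) hk ?_
    rw [hx', ← e, altProd_succ]

variable {M : CoxeterMatrix B}

/-- Extend a reduced factorization beginning with `j` by a letter `i` in front. As `i` is not a
descent of the alternating prefix, the letter deleted in exchange lies in the tail, so the total
length is kept. -/
theorem exists_altProd_mul (h : ExchangeSystem s N) (hM : HasBraidOrders s M)
    {i j : B} {w : G} (hi : N i w) (hj : N j w) {k : ℕ} (hk : k ≤ M i j) :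
    ∃ c : List B, w = altProd (s i) (s j) k * (c.map s).prod ∧ k + c.length = wordLength s w := by
  induction k generalizing i j with
  | zero =>
    obtain ⟨c, h1, h2⟩ := h.exists_reduced w
    exact ⟨c, by simp [altProd_zero, h1], by simp [h2]⟩
  | succ k ih =>
    obtain ⟨c, h1, h2⟩ := ih hj hi (by rw [M.symmetric]; omega)
    have hN := h.not_neg_altProd (hM.ne_of_lt i j) (k := k) (by omega)
    obtain ⟨c', h3, h4⟩ := h.exists_deletion hN (by rwa [← h1])
    refine ⟨c', ?_, by omega⟩
    rw [altProd_succ, mul_assoc, ← h4, ← h1, h.mul_cancel]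

/-- **Matsumoto's theorem**: elements of a monoid satisfying the braid relations have the same
product along any two reduced words of the same group element. -/
theorem prod_map_eq_of_reduced (h : ExchangeSystem s N) (hM : HasBraidOrders s M)
    {A : Type*} [Monoid A] (T : B → A)
    (hT : ∀ i j, altProd (T i) (T j) (M i j) = altProd (T j) (T i) (M i j)) (L L' : List B)
    (e : (L.map s).prod = (L'.map s).prod) (hL : L.length = wordLength s (L.map s).prod)
    (hL' : L'.length = wordLength s (L'.map s).prod) : (L.map T).prod = (L'.map T).prod := by
  obtain ⟨n, hn⟩ : ∃ n, L.length = n := ⟨_, rfl⟩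
  induction n generalizing L L' with
  | zero =>
    have h1 : L = [] := List.length_eq_zero_iff.1 hn
    have h2 : L' = [] := List.length_eq_zero_iff.1 (by rw [hL', ← e, ← hL, hn])
    rw [h1, h2]
  | succ n ih =>
    have hn' : L'.length = n + 1 := by rw [hL', ← e, ← hL, hn]
    have tail : ∀ (i : B) (L : List B), (i :: L).length = wordLength s ((i :: L).map s).prod →
        L.length = wordLength s (L.map s).prod ∧ N i ((i :: L).map s).prod := fun i L hL ↦ by
      have h1 := wordLength_le s L
      have h2 := h.wordLength_mul_le i (L.map s).prod
      rw [List.map_cons, List.prod_cons, List.length_cons] at hL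
      refine ⟨by omega, ?_⟩
      rw [h.neg_iff_lt, List.map_cons, List.prod_cons, h.mul_cancel]
      omega
    -- A reduced word and an alternating reduced word of the same element that share the first
    -- letter `i` have tails to which the induction hypothesis applies.
    have step : ∀ (i j : B) (L c : List B), (i :: L).length = n + 1 →
        (i :: L).length = wordLength s ((i :: L).map s).prod →
        ((i :: L).map s).prod = altProd (s i) (s j) (M i j) * (c.map s).prod →
        M i j + c.length = n + 1 →
        ((i :: L).map T).prod = altProd (T i) (T j) (M i j) * (c.map T).prod := by
      intro i j L c hlen hred hprod hc
      obtain ⟨m, hm⟩ := Nat.exists_eq_succ_of_ne_zero (hM.ne_zero i j)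
      rw [hm] at hprod hc ⊢
      have hp : (L.map s).prod = ((altList j i m ++ c).map s).prod := by
        rw [List.map_append, List.prod_append, prod_map_altList]
        rw [altProd_succ, mul_assoc, List.map_cons, List.prod_cons] at hprod
        exact mul_left_cancel hprod
      have := ih L (altList j i m ++ c) hp (tail i L hred).1
        (by rw [← hp, ← (tail i L hred).1]; simp [length_altList] at *; omega) (by simpa using hlen)
      rw [List.map_cons, List.prod_cons, this, List.map_append, List.prod_append, prod_map_altList,
        altProd_succ, mul_assoc]
    match L, L' with
    | [], _ => simp at hn
    | _, [] => simp at hn'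
    | i :: L, j :: L' =>
      by_cases hij : i = j
      · subst hij
        rw [List.map_cons, List.map_cons, List.prod_cons, List.prod_cons] at e ⊢
        rw [ih L L' (mul_left_cancel e) (tail i L hL).1 (tail i L' hL').1 (by simpa using hn)]
      -- With distinct first letters, the element has both descents, hence a reduced word beginning
      -- with the full braid word in `i` and `j`. The two given words are compared through it and
      -- `hT`.
      · have Ni := (tail i L hL).2
        have Nj := (tail j L' hL').2
        rw [← e] at Nj
        obtain ⟨c, h1, h2⟩ := h.exists_altProd_mul hM Ni Nj le_rfl
        rw [step i j L c hn hL h1 (by omega), step j i L' c hn' hL'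
          (by rw [← e, h1, M.symmetric j i, hM.braid]) (by rw [M.symmetric j i]; omega),
          M.symmetric j i, hT]

end ExchangeSystem

/-! ### The regular representation of the Hecke algebra. -/

section RegularRepresentation

variable {G B : Type*} [Group G] (s : B → G) (N : B → G → Prop) {K : Type*} [CommRing K] (q : Kˣ)

open Classical in
/-- The operator of left multiplication by the standard generator `T_i` in the free module on `G`. -/
def leftOp (i : B) : Module.End K (G →₀ K) :=
  Finsupp.linearCombination K fun w ↦
    if N i w then ((q : K) - 1) • Finsupp.single w 1 + (q : K) • Finsupp.single (s i * w) 1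
    else Finsupp.single (s i * w) 1

open Classical in
/-- The operator of right multiplication by the standard generator `T_i` in the free module on
`G`. -/
def rightOp (i : B) : Module.End K (G →₀ K) :=
  Finsupp.linearCombination K fun w ↦
    if N i w⁻¹ then ((q : K) - 1) • Finsupp.single w 1 + (q : K) • Finsupp.single (w * s i) 1
    else Finsupp.single (w * s i) 1

variable {s N}

theorem leftOp_of_neg {i : B} {w : G} (h : N i w) : leftOp s N q i (Finsupp.single w 1) =
    ((q : K) - 1) • Finsupp.single w 1 + (q : K) • Finsupp.single (s i * w) 1 := by
  simp [leftOp, h]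

theorem leftOp_of_not_neg {i : B} {w : G} (h : ¬ N i w) :
    leftOp s N q i (Finsupp.single w 1) = Finsupp.single (s i * w) 1 := by
  simp [leftOp, h]

theorem rightOp_of_neg {i : B} {w : G} (h : N i w⁻¹) : rightOp s N q i (Finsupp.single w 1) =
    ((q : K) - 1) • Finsupp.single w 1 + (q : K) • Finsupp.single (w * s i) 1 := by
  simp [rightOp, h]

theorem rightOp_of_not_neg {i : B} {w : G} (h : ¬ N i w⁻¹) :
    rightOp s N q i (Finsupp.single w 1) = Finsupp.single (w * s i) 1 := by
  simp [rightOp, h]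

namespace ExchangeSystem

theorem leftOp_sq (h : ExchangeSystem s N) (i : B) :
    leftOp s N q i ^ 2 = algebraMap K _ (q : K) + ((q : K) - 1) • leftOp s N q i := by
  refine Finsupp.lhom_ext' fun w ↦ LinearMap.ext_ring ?_
  have e := h.mul_iff i w
  simp only [pow_two, LinearMap.comp_apply, Finsupp.lsingle_apply, Module.End.mul_apply,
    LinearMap.add_apply, LinearMap.smul_apply, Module.algebraMap_end_apply]
  by_cases hw : N i w
  · rw [leftOp_of_neg q hw, map_add, map_smul, map_smul, leftOp_of_neg q hw,
      leftOp_of_not_neg q (by tauto), h.mul_cancel]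
    abel
  · rw [leftOp_of_not_neg q hw, leftOp_of_neg q (by tauto), h.mul_cancel]
    abel

/-- The two operators interfere only when `s i * w = w * s j`. Otherwise, by `exchange`,
multiplication on one side does not affect descents on the other. -/
theorem leftOp_rightOp_comm (h : ExchangeSystem s N) (i j : B) :
    leftOp s N q i * rightOp s N q j = rightOp s N q j * leftOp s N q i := by
  refine Finsupp.lhom_ext' fun w ↦ LinearMap.ext_ring ?_
  simp only [LinearMap.comp_apply, Finsupp.lsingle_apply, Module.End.mul_apply]
  have eR : N j (s i * w)⁻¹ ↔ N j (w⁻¹ * s i) := by rw [mul_inv_rev, h.inv_eq]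
  by_cases e : s i * w = w * s j
  · have hN := h.neg_iff_neg_inv e
    have hl := h.mul_iff i w
    have hr : N j (w * s j)⁻¹ ↔ ¬ N j w⁻¹ := by rw [mul_inv_rev, h.inv_eq, h.mul_iff]
    have e2 : w * s j * s j = w := by rw [mul_assoc, h.mul_self, mul_one]
    by_cases hw : N i w
    · rw [rightOp_of_neg q (hN.1 hw), leftOp_of_neg q hw, map_add, map_add, map_smul, map_smul,
        map_smul, map_smul, leftOp_of_neg q hw, rightOp_of_neg q (hN.1 hw), ← e,
        leftOp_of_not_neg q (by tauto), e, rightOp_of_not_neg q (by tauto), e2, ← e, h.mul_cancel]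
    · rw [rightOp_of_not_neg q (by tauto), leftOp_of_not_neg q hw, ← e, leftOp_of_neg q (by tauto),
        e, rightOp_of_neg q (by tauto), e2, ← e, h.mul_cancel]
  · have h1 : N i (w * s j) ↔ N i w := by
      by_contra h1
      exact e (h.exchange i j w (by tauto))
    have h2 : N j (s i * w)⁻¹ ↔ N j w⁻¹ := by
      rw [eR]
      by_contra h2
      have h3 := h.exchange j i w⁻¹ (by tauto)
      refine e ?_
      rw [← inv_inj, mul_inv_rev, mul_inv_rev, h.inv_eq, h.inv_eq]
      exact h3.symm
    by_cases hi : N i w <;> by_cases hj : N j w⁻¹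
    · rw [rightOp_of_neg q hj, leftOp_of_neg q hi, map_add, map_add, map_smul, map_smul,
        map_smul, map_smul, leftOp_of_neg q hi, rightOp_of_neg q hj, leftOp_of_neg q (by tauto),
        rightOp_of_neg q (by tauto), mul_assoc]
      module
    · rw [rightOp_of_not_neg q hj, leftOp_of_neg q hi, map_add, map_smul,
        map_smul, rightOp_of_not_neg q hj, leftOp_of_neg q (by tauto),
        rightOp_of_not_neg q (by tauto), mul_assoc]
    · rw [rightOp_of_neg q hj, leftOp_of_not_neg q hi, map_add, map_smul, map_smul,
        leftOp_of_not_neg q hi, leftOp_of_not_neg q (by tauto), rightOp_of_neg q (by tauto),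
        mul_assoc]
    · rw [rightOp_of_not_neg q hj, leftOp_of_not_neg q hi, leftOp_of_not_neg q (by tauto),
        rightOp_of_not_neg q (by tauto), mul_assoc]

/-- Operators commuting with all right multiplications are determined by their value at `1`. -/
theorem ext_of_commute (h : ExchangeSystem s N)
    {A A' : Module.End K (G →₀ K)} (hA : ∀ j, Commute A (rightOp s N q j))
    (hA' : ∀ j, Commute A' (rightOp s N q j))
    (e : A (Finsupp.single 1 1) = A' (Finsupp.single 1 1)) : A = A' := by
  have hr : ∀ j v, A v = A' v → A (rightOp s N q j v) = A' (rightOp s N q j v) := fun j v hv ↦ by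
    have h1 := LinearMap.congr_fun (hA j) v
    have h2 := LinearMap.congr_fun (hA' j) v
    simp only [Module.End.mul_apply] at h1 h2
    rw [h1, h2, hv]
  refine Finsupp.lhom_ext' fun w ↦ LinearMap.ext_ring ?_
  simp only [LinearMap.comp_apply, Finsupp.lsingle_apply]
  obtain ⟨L, rfl⟩ := h.exists_word w
  induction L using List.reverseRecOn with
  | nil => simpa using e
  | append_singleton L j ih =>
    rw [List.map_append, List.prod_append, List.map_singleton, List.prod_singleton]
    have h1 := hr j _ ih
    by_cases hN : N j (L.map s).prod⁻¹
    · rw [rightOp_of_neg q hN, map_add, map_add, map_smul, map_smul, map_smul, map_smul, ih] at h1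
      -- Invertibility of `q` isolates the basis vector of the longer word.
      have h2 := congrArg (fun v ↦ (↑q⁻¹ : K) • v) (add_left_cancel h1)
      simpa [smul_smul] using h2
    · rwa [rightOp_of_not_neg q hN] at h1

variable {M : CoxeterMatrix B}

/-- Both sides commute with right multiplications, so it suffices to compare them on the basis
vector `1`. There no descent is met, and the relation is the one in the group. -/
theorem leftOp_braid (h : ExchangeSystem s N) (hM : HasBraidOrders s M)
    (i j : B) : altProd (leftOp s N q i) (leftOp s N q j) (M i j) =
    altProd (leftOp s N q j) (leftOp s N q i) (M i j) := by
  have hc : ∀ i j k m, Commute (altProd (leftOp s N q i) (leftOp s N q j) m)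
      (rightOp s N q k) := fun i j k m ↦ by
    induction m generalizing i j with
    | zero => rw [altProd_zero]; exact Commute.one_left _
    | succ m ih => rw [altProd_succ]; exact Commute.mul_left (h.leftOp_rightOp_comm q i k) (ih _ _)
  have h1 : ∀ i j m, m ≤ M i j → altProd (leftOp s N q i) (leftOp s N q j) m (Finsupp.single 1 1) =
      Finsupp.single (altProd (s i) (s j) m) 1 := fun i j m hm ↦ by
    induction m generalizing i j with
    | zero => simp [altProd_zero]
    | succ m ih =>
      rw [altProd_succ, Module.End.mul_apply, ih j i (by rw [M.symmetric]; omega),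
        leftOp_of_not_neg q (h.not_neg_altProd (hM.ne_of_lt i j) (by omega)), altProd_succ]
  refine h.ext_of_commute q (hc i j · _) (hc j i · _) ?_
  rw [h1 i j _ le_rfl, h1 j i _ (M.symmetric i j).le, hM.braid]

/-- The left regular representation of the Hecke algebra on the free module on `G`. -/
def regularRep (h : ExchangeSystem s N) (hM : HasBraidOrders s M)
    : HeckeAlgebra M (q : K) →ₐ[K] Module.End K (G →₀ K) :=
  RingQuot.liftAlgHom K ⟨FreeAlgebra.lift K (leftOp s N q), by
    rintro _ _ (⟨i⟩ | ⟨i, j, -⟩)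
    · simpa using h.leftOp_sq q i
    · simpa only [map_altProd, FreeAlgebra.lift_ι_apply] using h.leftOp_braid q hM i j⟩

theorem regularRep_heckeGen (h : ExchangeSystem s N) (hM : HasBraidOrders s M) (i : B) :
    h.regularRep q hM (heckeGen M (q : K) i) = leftOp s N q i := by
  simp [regularRep, heckeGen]

end ExchangeSystem

end RegularRepresentation

/-! ### A spanning family indexed by the group. -/

section Hecke

variable {B : Type*} {M : CoxeterMatrix B} {K : Type*} [CommRing K]

theorem heckeGen_braid (q : K) (i j : B) (hij : M i j ≠ 0) :
    altProd (heckeGen M q i) (heckeGen M q j) (M i j) =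
      altProd (heckeGen M q j) (heckeGen M q i) (M i j) := by
  have h := RingQuot.mkAlgHom_rel K (HeckeRel.braid (M := M) (q := q) i j hij)
  simpa only [map_altProd, heckeGen] using h

theorem heckeAlgebra_algHom_ext {q : K} {A : Type*} [Semiring A] [Algebra K A]
    {f g : HeckeAlgebra M q →ₐ[K] A} (e : ∀ i, f (heckeGen M q i) = g (heckeGen M q i)) :
    f = g := by
  apply RingQuot.ringQuot_ext'
  ext i
  exact e i

theorem heckeAlgebra_mem_of_left_mul {q : K} (S : Submodule K (HeckeAlgebra M q)) (h1 : 1 ∈ S)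
    (hmul : ∀ i, ∀ x ∈ S, heckeGen M q i * x ∈ S) (x : HeckeAlgebra M q) : x ∈ S := by
  obtain ⟨a, rfl⟩ := RingQuot.mkAlgHom_surjective K (HeckeRel M q) x
  have key : ∀ y ∈ S, RingQuot.mkAlgHom K (HeckeRel M q) a * y ∈ S := by
    induction a using FreeAlgebra.induction with
    | grade0 r =>
      intro y hy
      rw [AlgHom.commutes, ← Algebra.smul_def]
      exact S.smul_mem r hy
    | grade1 i => exact hmul i
    | mul a b ha hb =>
      intro y hy
      rw [map_mul, mul_assoc]
      exact ha _ (hb _ hy)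
    | add a b ha hb =>
      intro y hy
      rw [map_add, add_mul]
      exact S.add_mem (ha _ hy) (hb _ hy)
  simpa using key 1 h1

variable {G : Type*} [Group G] {s : B → G} {N : B → G → Prop}

/-- The product of the generators of the Hecke algebra along a reduced word of `w`. -/
def ExchangeSystem.basisElt (h : ExchangeSystem s N) (M : CoxeterMatrix B) (q : K) (w : G) :
    HeckeAlgebra M q :=
  ((h.exists_reduced w).choose.map (heckeGen M q)).prod

/-- The span contains `1` and is stable under left multiplication by generators: an ascent lengthens
a reduced word, where Matsumoto's theorem removes the dependence on the word, and a descent is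
handled by the quadratic relation. -/
theorem ExchangeSystem.span_basisElt (h : ExchangeSystem s N) (hM : HasBraidOrders s M) (q : K) :
    Submodule.span K (Set.range (h.basisElt M q)) = ⊤ := by
  have hw : ∀ L : List B, L.length = wordLength s (L.map s).prod →
      h.basisElt M q (L.map s).prod = (L.map (heckeGen M q)).prod := fun L hL ↦ by
    have hc := (h.exists_reduced (L.map s).prod).choose_spec
    exact h.prod_map_eq_of_reduced hM _ (fun i j ↦ heckeGen_braid q i j (hM.ne_zero i j)) _ _
      hc.1 (by rw [hc.1, hc.2]) hL
  have hmul : ∀ i w, ¬ N i w →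
      h.basisElt M q (s i * w) = heckeGen M q i * h.basisElt M q w := fun i w hN ↦ by
    obtain ⟨L, rfl, hL⟩ := h.exists_reduced w
    rw [hw L hL]
    refine hw (i :: L) ?_
    rw [List.map_cons, List.prod_cons, h.wordLength_of_not_neg hN, ← hL]; rfl
  rw [Submodule.eq_top_iff']
  refine heckeAlgebra_mem_of_left_mul _ ?_ fun i x hx ↦ ?_
  · have h0 : wordLength s 1 = 0 := by simpa using wordLength_le s []
    have := hw [] (by simp [h0])
    simp only [List.map_nil, List.prod_nil] at this
    rw [← this]
    exact Submodule.subset_span ⟨_, rfl⟩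
  · induction hx using Submodule.span_induction with
    | mem x hx =>
      obtain ⟨w, rfl⟩ := hx
      by_cases hN : N i w
      · have e := hmul i (s i * w) (by rw [h.mul_iff]; tauto)
        rw [h.mul_cancel] at e
        have e2 : heckeGen M q i * h.basisElt M q w =
            q • h.basisElt M q (s i * w) + (q - 1) • h.basisElt M q w := by
          rw [e, ← mul_assoc, ← pow_two, heckeGen_sq, add_mul, smul_mul_assoc, ← Algebra.smul_def]
        rw [e2]
        exact add_mem (Submodule.smul_mem _ _ (Submodule.subset_span ⟨_, rfl⟩))
          (Submodule.smul_mem _ _ (Submodule.subset_span ⟨_, rfl⟩))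
      · rw [← hmul i w hN]
        exact Submodule.subset_span ⟨_, rfl⟩
    | zero => simp
    | add x y _ _ hx hy => rw [mul_add]; exact add_mem hx hy
    | smul a x _ hx => rw [mul_smul_comm]; exact Submodule.smul_mem _ _ hx

end Hecke

/-! ### The affine Weyl group as permutations of `ℤ`. -/

/-- The integers `k` such that the `i`-th reflection of the affine Weyl group of type `C̃ₙ` swaps `k`
and `k + 1`. -/
def AffUp (n : ℕ) (i k : ℤ) : Prop := (2 * n : ℤ) ∣ k - (i - 1) ∨ (2 * n : ℤ) ∣ k + i + 1

/-- Both congruences force `k` to have the parity of `i - 1`. Hence the pairs swapped by a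
reflection are disjoint. -/
theorem AffUp.not_succ {n : ℕ} {i k : ℤ} (h : AffUp n i k) : ¬ AffUp n i (k + 1) := by
  have key : ∀ a : ℤ, (2 * n : ℤ) ∣ a → (2 : ℤ) ∣ a := fun a ↦ (Dvd.intro _ rfl).trans
  rintro (h' | h') <;> rcases h with h | h <;> have := key _ h <;> have := key _ h' <;> omega

theorem affUp_self (n : ℕ) (i : ℤ) : AffUp n i (i - 1) := Or.inl (by simp)

theorem affUp_add (n : ℕ) (i k : ℤ) : AffUp n i (k + 2 * n) ↔ AffUp n i k := by
  have e1 : k + 2 * n - (i - 1) = k - (i - 1) + 2 * n := by ring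
  have e2 : k + 2 * n + i + 1 = k + i + 1 + 2 * n := by ring
  rw [AffUp, AffUp, e1, e2, dvd_add_self_right, dvd_add_self_right]

theorem affUp_neg (n : ℕ) (i k : ℤ) : AffUp n i (-2 - k) ↔ AffUp n i k := by
  have e1 : -2 - k - (i - 1) = -(k + i + 1) := by ring
  have e2 : -2 - k + i + 1 = -(k - (i - 1)) := by ring
  rw [AffUp, AffUp, e1, e2, dvd_neg, dvd_neg, or_comm]

open Classical in
/-- The map underlying `affRefl`. -/
def affReflFun (n : ℕ) (i k : ℤ) : ℤ :=
  if AffUp n i k then k + 1 else if AffUp n i (k - 1) then k - 1 else k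

theorem affReflFun_involutive (n : ℕ) (i : ℤ) : Function.Involutive (affReflFun n i) := by
  intro k
  by_cases h1 : AffUp n i k
  · simp [affReflFun, h1, h1.not_succ]
  · by_cases h2 : AffUp n i (k - 1)
    · simp [affReflFun, h1, h2]
    · simp [affReflFun, h1, h2]

/-- The `i`-th simple reflection of the affine Weyl group of type `C̃ₙ`, as a permutation of `ℤ`. -/
def affRefl (n : ℕ) (i : ℤ) : Equiv.Perm ℤ := (affReflFun_involutive n i).toPerm

theorem affRefl_of_up {n : ℕ} {i k : ℤ} (h : AffUp n i k) : affRefl n i k = k + 1 := if_pos h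

theorem affRefl_of_up_pred {n : ℕ} {i k : ℤ} (h : AffUp n i (k - 1)) :
    affRefl n i k = k - 1 := by
  have h' : ¬ AffUp n i k := by simpa using h.not_succ
  exact (if_neg h').trans (if_pos h)

theorem affRefl_of_not {n : ℕ} {i k : ℤ} (h : ¬ AffUp n i k) (h' : ¬ AffUp n i (k - 1)) :
    affRefl n i k = k := (if_neg h).trans (if_neg h')

theorem affRefl_affRefl (n : ℕ) (i k : ℤ) : affRefl n i (affRefl n i k) = k :=
  affReflFun_involutive n i k

theorem affRefl_mul_self (n : ℕ) (i : ℤ) : affRefl n i * affRefl n i = 1 :=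
  Equiv.ext (affRefl_affRefl n i)

theorem affRefl_inv (n : ℕ) (i : ℤ) : (affRefl n i)⁻¹ = affRefl n i :=
  inv_eq_of_mul_eq_one_left (affRefl_mul_self n i)

theorem affRefl_pred_self (n : ℕ) (i : ℤ) : affRefl n i (i - 1) = i := by
  rw [affRefl_of_up (affUp_self n i), sub_add_cancel]

theorem affRefl_self (n : ℕ) (i : ℤ) : affRefl n i i = i - 1 :=
  affRefl_of_up_pred (affUp_self n i)

/-- Permutations of `ℤ` which are periodic modulo `2 n` and commute with `k ↦ -1 - k`. -/
structure IsAffSigned (n : ℕ) (w : Equiv.Perm ℤ) : Prop where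
  add : ∀ k, w (k + 2 * n) = w k + 2 * n
  neg : ∀ k, w (-1 - k) = -1 - w k

theorem isAffSigned_affRefl (n : ℕ) (i : ℤ) : IsAffSigned n (affRefl n i) where
  add k := by
    have h1 := affUp_add n i k
    have h2 := affUp_add n i (k - 1)
    have e : k - 1 + 2 * n = k + 2 * n - 1 := by ring
    rw [e] at h2
    by_cases hk : AffUp n i k
    · rw [affRefl_of_up hk, affRefl_of_up (h1.2 hk)]; ring
    · by_cases hk' : AffUp n i (k - 1)
      · rw [affRefl_of_up_pred hk', affRefl_of_up_pred (h2.2 hk')]; ring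
      · rw [affRefl_of_not hk hk', affRefl_of_not (by tauto) (by tauto)]
  neg k := by
    have h1 := affUp_neg n i k
    have h2 := affUp_neg n i (k - 1)
    have e1 : -2 - (k - 1) = -1 - k := by ring
    have e2 : -2 - k = -1 - k - 1 := by ring
    rw [e1] at h2
    rw [e2] at h1
    by_cases hk : AffUp n i k
    · rw [affRefl_of_up hk, affRefl_of_up_pred (h1.2 hk)]; ring
    · by_cases hk' : AffUp n i (k - 1)
      · rw [affRefl_of_up_pred hk', affRefl_of_up (h2.2 hk')]; ring
      · rw [affRefl_of_not hk hk', affRefl_of_not (by tauto) (by tauto)]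

namespace IsAffSigned

variable {n : ℕ} {w w' : Equiv.Perm ℤ}

theorem one (n : ℕ) : IsAffSigned n 1 := ⟨fun _ ↦ rfl, fun _ ↦ rfl⟩

theorem mul (h : IsAffSigned n w) (h' : IsAffSigned n w') : IsAffSigned n (w * w') where
  add k := by simp [h.add, h'.add]
  neg k := by simp [h.neg, h'.neg]

theorem inv (h : IsAffSigned n w) : IsAffSigned n w⁻¹ where
  add k := by rw [Equiv.Perm.inv_eq_iff_eq, h.add, show w (w⁻¹ k) = k from w.apply_symm_apply k]
  neg k := by rw [Equiv.Perm.inv_eq_iff_eq, h.neg, show w (w⁻¹ k) = k from w.apply_symm_apply k]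

theorem add_mul (h : IsAffSigned n w) (k m : ℤ) : w (k + 2 * n * m) = w k + 2 * n * m := by
  induction m with
  | zero => simp
  | succ m ih => rw [mul_add, ← add_assoc, mul_one, h.add, ih]; ring
  | pred m ih =>
    have := h.add (k + 2 * n * (-m - 1))
    have e : k + 2 * n * (-m - 1) + 2 * n = k + 2 * n * (-m : ℤ) := by ring
    rw [e, ih] at this
    linarith

theorem sub_eq (h : IsAffSigned n w) {k a : ℤ} (hk : (2 * n : ℤ) ∣ k - a) :
    w k - w a = k - a := by
  obtain ⟨m, hm⟩ := hk
  rw [eq_add_of_sub_eq' hm, h.add_mul]; ring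

theorem add_eq (h : IsAffSigned n w) {k a : ℤ} (hk : (2 * n : ℤ) ∣ k + a + 1) :
    w k + w a + 1 = k + a + 1 := by
  have := h.sub_eq (k := k) (a := -1 - a) (by convert hk using 1; ring)
  rw [h.neg] at this
  linarith

theorem dvd_sub_iff (h : IsAffSigned n w) (k a : ℤ) :
    (2 * n : ℤ) ∣ w k - w a ↔ (2 * n : ℤ) ∣ k - a := by
  refine ⟨fun hk ↦ ?_, fun hk ↦ by rwa [h.sub_eq hk]⟩
  have := h.inv.sub_eq hk
  rw [show w⁻¹ (w k) = k from w.symm_apply_apply k,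
    show w⁻¹ (w a) = a from w.symm_apply_apply a] at this
  rwa [this]

theorem dvd_add_iff (h : IsAffSigned n w) (k a : ℤ) :
    (2 * n : ℤ) ∣ w k + w a + 1 ↔ (2 * n : ℤ) ∣ k + a + 1 := by
  refine ⟨fun hk ↦ ?_, fun hk ↦ by rwa [h.add_eq hk]⟩
  have := h.inv.add_eq hk
  rw [show w⁻¹ (w k) = k from w.symm_apply_apply k,
    show w⁻¹ (w a) = a from w.symm_apply_apply a] at this
  rwa [this]

/-- The pairs swapped by a reflection are the translates and mirror images of any one of them. Since
`w` respects both symmetries, matching one pair matches all, so `w` conjugates one reflection to the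
other. -/
theorem affRefl_mul_of_up (h : IsAffSigned n w) {i j a : ℤ} (ha : AffUp n j a) (h0 : w a = i - 1)
    (h1 : w (a + 1) = i) : affRefl n i * w = w * affRefl n j := by
  have hj : ∀ k, AffUp n j k ↔ ((2 * n : ℤ) ∣ k - a ∨ (2 * n : ℤ) ∣ k + (a + 1) + 1) := fun k ↦ by
    rcases ha with ha | ha
    · have e1 : k - (j - 1) = k - a + (a - (j - 1)) := by ring
      have e2 : k + j + 1 = k + (a + 1) + 1 - (a - (j - 1)) := by ring
      rw [AffUp, e1, e2, dvd_add_left ha, dvd_sub_left ha]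
    · have e1 : k - (j - 1) = k + (a + 1) + 1 - (a + j + 1) := by ring
      have e2 : k + j + 1 = k - a + (a + j + 1) := by ring
      rw [AffUp, e1, e2, dvd_add_left ha, dvd_sub_left ha, or_comm]
  have hi : ∀ k, AffUp n i (w k) ↔ AffUp n j k := fun k ↦ by
    rw [hj, ← h.dvd_sub_iff, ← h.dvd_add_iff, h0, h1, AffUp]
  have hs : ∀ k, AffUp n j k → w (k + 1) = w k + 1 := fun k hk ↦ by
    rcases (hj k).1 hk with hk | hk
    · have e1 := h.sub_eq hk
      have e2 := h.sub_eq (k := k + 1) (a := a + 1) (by convert hk using 1; ring)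
      linarith
    · have e1 := h.add_eq hk
      have e2 := h.add_eq (k := k + 1) (a := a) (by convert hk using 1; ring)
      linarith
  ext k
  rw [Equiv.Perm.mul_apply, Equiv.Perm.mul_apply]
  by_cases hk : AffUp n j k
  · rw [affRefl_of_up hk, affRefl_of_up ((hi k).2 hk), hs k hk]
  · have hk0 : ¬ AffUp n i (w k) := by rwa [hi]
    by_cases hk' : AffUp n j (k - 1)
    · have e := hs _ hk'
      rw [sub_add_cancel] at e
      rw [affRefl_of_up_pred hk', affRefl_of_up_pred (by rwa [e, add_sub_cancel_right, hi]), e]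
      ring
    · rw [affRefl_of_not hk hk', affRefl_of_not hk0]
      intro h2
      obtain ⟨k', hk2⟩ := w.surjective (w k - 1)
      rw [← hk2, hi] at h2
      have e := hs k' h2
      rw [hk2, sub_add_cancel] at e
      rw [← w.injective e, add_sub_cancel_right] at hk'
      exact hk' h2

theorem affRefl_mul_of_up' (h : IsAffSigned n w) {i j a : ℤ} (ha : AffUp n j a)
    (h0 : w a = i) (h1 : w (a + 1) = i - 1) : affRefl n i * w = w * affRefl n j := by
  have e : affRefl n j (a + 1) = a := by
    rw [affRefl_of_up_pred (by simpa using ha)]; ring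
  have := (h.mul (isAffSigned_affRefl n j)).affRefl_mul_of_up (i := i) ha
    (by rw [Equiv.Perm.mul_apply, affRefl_of_up ha, h1])
    (by rw [Equiv.Perm.mul_apply, e, h0])
  rw [← mul_assoc, mul_assoc w, affRefl_mul_self, mul_one] at this
  rw [← mul_inv_eq_iff_eq_mul, affRefl_inv, this]

end IsAffSigned

/-- The affine Weyl group of type `C̃ₙ`, as a group of permutations of `ℤ`. -/
def affGroup (n : ℕ) : Subgroup (Equiv.Perm ℤ) :=
  Subgroup.closure (Set.range fun i : Fin (n + 1) ↦ affRefl n ((i : ℕ) : ℤ))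

theorem isAffSigned_of_mem {n : ℕ} {w : Equiv.Perm ℤ} (hw : w ∈ affGroup n) : IsAffSigned n w := by
  induction hw using Subgroup.closure_induction with
  | mem x hx => obtain ⟨i, rfl⟩ := hx; exact isAffSigned_affRefl n _
  | one => exact IsAffSigned.one n
  | mul x y _ _ hx hy => exact hx.mul hy
  | inv x _ hx => exact hx.inv

/-- The generators of `affGroup n`. -/
def affGen (n : ℕ) (i : Fin (n + 1)) : affGroup n :=
  ⟨affRefl n ((i : ℕ) : ℤ), Subgroup.subset_closure ⟨i, rfl⟩⟩

theorem coe_affGen (n : ℕ) (i : Fin (n + 1)) :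
    (affGen n i : Equiv.Perm ℤ) = affRefl n ((i : ℕ) : ℤ) := rfl

/-- The left descents of the elements of `affGroup n`. -/
def AffNeg (n : ℕ) (i : Fin (n + 1)) (w : affGroup n) : Prop :=
  (w : Equiv.Perm ℤ)⁻¹ (i : ℕ) < (w : Equiv.Perm ℤ)⁻¹ ((i : ℕ) - 1)

theorem exists_word_affGen (n : ℕ) (w : affGroup n) :
    ∃ L : List (Fin (n + 1)), (L.map (affGen n)).prod = w := by
  obtain ⟨w, hw⟩ := w
  induction hw using Subgroup.closure_induction with
  | mem x hx => obtain ⟨i, rfl⟩ := hx; exact ⟨[i], by simp [affGen]⟩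
  | one => exact ⟨[], rfl⟩
  | mul x y _ _ hx hy =>
    obtain ⟨L, hL⟩ := hx
    obtain ⟨L', hL'⟩ := hy
    exact ⟨L ++ L', by rw [List.map_append, List.prod_append, hL, hL']; rfl⟩
  | inv x hx' hx =>
    obtain ⟨L, hL⟩ := hx
    refine ⟨L.reverse, ?_⟩
    have e : ∀ i, (affGen n i)⁻¹ = affGen n i := fun i ↦ Subtype.ext (affRefl_inv n _)
    have : (⟨x, hx'⟩ : affGroup n)⁻¹ = (L.reverse.map (affGen n)).prod := by
      rw [← hL, List.prod_inv_reverse, List.map_map, List.map_reverse]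
      exact congrArg _ (congrArg _ (List.map_congr_left fun i _ ↦ e i))
    rw [← this]; rfl

theorem affExchangeSystem (n : ℕ) : ExchangeSystem (affGen n) (AffNeg n) where
  mul_self i := Subtype.ext (affRefl_mul_self n _)
  exists_word := exists_word_affGen n
  not_one i := by simp [AffNeg]
  mul_iff i w := by
    have hne : (w : Equiv.Perm ℤ)⁻¹ ((i : ℕ) - 1) ≠ (w : Equiv.Perm ℤ)⁻¹ (i : ℕ) := fun h ↦ by
      have := (w : Equiv.Perm ℤ)⁻¹.injective h
      omega
    rw [AffNeg, AffNeg, Subgroup.coe_mul, mul_inv_rev, coe_affGen, affRefl_inv,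
      Equiv.Perm.mul_apply, Equiv.Perm.mul_apply, affRefl_self, affRefl_pred_self]
    omega
  exchange i j w hN := by
    rw [AffNeg, AffNeg, Subgroup.coe_mul, mul_inv_rev, coe_affGen, affRefl_inv,
      Equiv.Perm.mul_apply, Equiv.Perm.mul_apply] at hN
    have hx : (w : Equiv.Perm ℤ) ((w : Equiv.Perm ℤ)⁻¹ (i : ℕ)) = (i : ℕ) :=
      (w : Equiv.Perm ℤ).apply_symm_apply _
    have hy : (w : Equiv.Perm ℤ) ((w : Equiv.Perm ℤ)⁻¹ ((i : ℕ) - 1)) = (i : ℕ) - 1 :=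
      (w : Equiv.Perm ℤ).apply_symm_apply _
    generalize (w : Equiv.Perm ℤ)⁻¹ ((i : ℕ) : ℤ) = x at hN hx
    generalize (w : Equiv.Perm ℤ)⁻¹ (((i : ℕ) : ℤ) - 1) = y at hN hy
    have hw := isAffSigned_of_mem w.2
    have hxy : x ≠ y := fun h ↦ by rw [h, hy] at hx; omega
    have bound : ∀ k, (affRefl n ((j : ℕ) : ℤ) k = k + 1 ∧ AffUp n ((j : ℕ) : ℤ) k) ∨
        (affRefl n ((j : ℕ) : ℤ) k = k - 1 ∧ AffUp n ((j : ℕ) : ℤ) (k - 1)) ∨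
        affRefl n ((j : ℕ) : ℤ) k = k := fun k ↦ by
      by_cases h1 : AffUp n ((j : ℕ) : ℤ) k
      · exact Or.inl ⟨affRefl_of_up h1, h1⟩
      · by_cases h2 : AffUp n ((j : ℕ) : ℤ) (k - 1)
        · exact Or.inr (Or.inl ⟨affRefl_of_up_pred h2, h2⟩)
        · exact Or.inr (Or.inr (affRefl_of_not h1 h2))
    have hinj : affRefl n ((j : ℕ) : ℤ) x ≠ affRefl n ((j : ℕ) : ℤ) y :=
      fun h ↦ hxy ((affRefl n _).injective h)
    -- A reflection moves every integer by at most 1, so it reverses the order of `x` and `y` only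
    -- if they are consecutive and it swaps them.
    have cases : (y = x + 1 ∧ AffUp n ((j : ℕ) : ℤ) x) ∨ (x = y + 1 ∧ AffUp n ((j : ℕ) : ℤ) y) := by
      have up_pred : ∀ {k : ℤ}, AffUp n ((j : ℕ) : ℤ) (k - 1) → ¬ AffUp n ((j : ℕ) : ℤ) k :=
        fun h ↦ by simpa using h.not_succ
      have of_eq : ∀ {k l : ℤ}, AffUp n ((j : ℕ) : ℤ) k → k = l → AffUp n ((j : ℕ) : ℤ) l :=
        fun h e ↦ e ▸ h
      by_cases hlt : x < y
      · refine Or.inl ?_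
        rcases bound x with ⟨h1, h2⟩ | ⟨h1, h2⟩ | h1 <;>
          rcases bound y with ⟨h3, h4⟩ | ⟨h3, h4⟩ | h3
        · omega
        · refine ⟨?_, h2⟩
          by_contra hne
          have h5 : y - 1 ≠ x + 1 := fun h ↦ h2.not_succ (h ▸ h4)
          omega
        · exact ⟨by omega, h2⟩
        all_goals omega
      · refine Or.inr ?_
        rcases bound x with ⟨h1, h2⟩ | ⟨h1, h2⟩ | h1 <;>
          rcases bound y with ⟨h3, h4⟩ | ⟨h3, h4⟩ | h3
        · omega
        · omega
        · omega
        · refine ⟨?_, h4⟩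
          by_contra hne
          have h5 : x - 1 ≠ y + 1 := fun h ↦ h4.not_succ (h ▸ h2)
          omega
        · omega
        · exact ⟨by omega, of_eq h2 (by omega)⟩
        · exact ⟨by omega, h4⟩
        all_goals omega
    apply Subtype.ext
    rcases cases with ⟨rfl, hu⟩ | ⟨rfl, hu⟩
    · exact hw.affRefl_mul_of_up' hu hx hy
    · exact hw.affRefl_mul_of_up hu hy hx

/-- Once the four excluded values are removed, the quantities tested by `AffUp` lie strictly between
`-2n` and `2n` and are nonzero. -/
theorem affRefl_fixed {n : ℕ} {i k : ℤ} (hi : 0 ≤ i) (hin : i ≤ n) (hk : -n ≤ k) (hkn : k < n)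
    (h1 : k ≠ i - 1) (h2 : k ≠ i) (h3 : k ≠ -1 - i) (h4 : k ≠ -i) : affRefl n i k = k := by
  have key : ∀ a : ℤ, a < 2 * n → -(2 * n) < a → (2 * n : ℤ) ∣ a → a = 0 := fun a ha ha' hd ↦
    Int.eq_zero_of_abs_lt_dvd hd (abs_lt.2 ⟨ha', ha⟩)
  refine affRefl_of_not ?_ ?_
  · rintro (h | h) <;> have := key _ (by omega) (by omega) h <;> omega
  · rintro (h | h) <;> have := key _ (by omega) (by omega) h <;> omega

/-! ### Braid relations among the reflections, and their minimality. -/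

section Braid

variable {n : ℕ} {i j : ℤ}

/-- Here and in the longer braid relations, the relation is read as `s * w = w * s'`, so that
following two consecutive values of `w` suffices. -/
theorem affRefl_comm (hi : 0 ≤ i) (hij : i + 1 < j) (hj : j ≤ n) :
    affRefl n i * affRefl n j = affRefl n j * affRefl n i := by
  refine (isAffSigned_affRefl n j).affRefl_mul_of_up (affUp_self n i) ?_ ?_
  · exact affRefl_fixed (by omega) (by omega) (by omega) (by omega) (by omega) (by omega)
      (by omega) (by omega)
  · rw [sub_add_cancel]
    exact affRefl_fixed (by omega) (by omega) (by omega) (by omega) (by omega) (by omega)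
      (by omega) (by omega)

theorem affRefl_ne (hi : 0 ≤ i) (hij : i < j) (hj : j ≤ n) : affRefl n i ≠ affRefl n j := by
  intro h
  have h1 := Equiv.congr_fun h i
  rw [affRefl_self] at h1
  rcases eq_or_ne j (i + 1) with rfl | hne
  · have := affRefl_pred_self n (i + 1)
    rw [add_sub_cancel_right] at this
    omega
  · rw [affRefl_fixed (by omega) (by omega) (by omega) (by omega) (by omega) (by omega)
      (by omega) (by omega)] at h1
    omega

theorem affRefl_braid_three (hi : 1 ≤ i) (hj : i + 1 < n) :
    affRefl n i * (affRefl n (i + 1) * affRefl n i) =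
      affRefl n (i + 1) * affRefl n i * affRefl n (i + 1) := by
  refine ((isAffSigned_affRefl n _).mul (isAffSigned_affRefl n i)).affRefl_mul_of_up
    (affUp_self n (i + 1)) ?_ ?_
  · rw [add_sub_cancel_right, Equiv.Perm.mul_apply, affRefl_self]
    exact affRefl_fixed (by omega) (by omega) (by omega) (by omega) (by omega) (by omega)
      (by omega) (by omega)
  · rw [add_sub_cancel_right, Equiv.Perm.mul_apply, affRefl_fixed (k := i + 1) (by omega) (by omega)
      (by omega) (by omega) (by omega) (by omega) (by omega) (by omega), affRefl_self,
      add_sub_cancel_right]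

theorem affRefl_mul_ne (hn : 2 ≤ n) (hi : 0 ≤ i) (hj : i + 1 ≤ n) :
    affRefl n i * affRefl n (i + 1) ≠ affRefl n (i + 1) * affRefl n i := by
  intro h
  have e := affRefl_pred_self n (i + 1)
  rw [add_sub_cancel_right] at e
  have h1 := Equiv.congr_fun h (i - 1)
  rw [Equiv.Perm.mul_apply, Equiv.Perm.mul_apply, affRefl_pred_self, e] at h1
  -- For `i = 0` the point `i - 1` is the mirror image of `0`, so the reflection `i + 1` does not
  -- fix it.
  rcases hi.eq_or_lt with rfl | hi
  · have e2 := (isAffSigned_affRefl n (0 + 1)).neg 0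
    rw [e] at e2
    rw [show (0 - 1 : ℤ) = -1 - 0 by ring, e2, (isAffSigned_affRefl n 0).neg,
      affRefl_fixed (by omega) (by omega) (by omega) (by omega) (by omega) (by omega)
      (by omega) (by omega)] at h1
    omega
  · rw [affRefl_fixed (i := i + 1) (by omega) (by omega) (by omega) (by omega) (by omega) (by omega)
      (by omega) (by omega), affRefl_pred_self] at h1
    omega

theorem affRefl_mul_mul_zero (hn : 2 ≤ n) :
    (affRefl n 1 * (affRefl n 0 * affRefl n 1)) 0 = 0 := by
  have e : affRefl n 1 0 = 1 := by simpa using affRefl_pred_self n 1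
  rw [Equiv.Perm.mul_apply, Equiv.Perm.mul_apply, e, affRefl_fixed (i := 0) (k := 1) (by omega) (by omega)
    (by omega) (by omega) (by omega) (by omega) (by omega) (by omega), affRefl_self, sub_self]

theorem affRefl_braid_four_zero (hn : 2 ≤ n) :
    affRefl n 0 * (affRefl n 1 * (affRefl n 0 * affRefl n 1)) =
      affRefl n 1 * (affRefl n 0 * affRefl n 1) * affRefl n 0 := by
  have hw := (isAffSigned_affRefl n 1).mul ((isAffSigned_affRefl n 0).mul (isAffSigned_affRefl n 1))
  have h0 := affRefl_mul_mul_zero hn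
  refine hw.affRefl_mul_of_up (affUp_self n 0) ?_ (by simpa using h0)
  have := hw.neg 0
  rw [h0] at this
  simpa using this

theorem affRefl_mul_mul_ne_zero (hn : 2 ≤ n) :
    affRefl n 0 * (affRefl n 1 * affRefl n 0) ≠ affRefl n 1 * (affRefl n 0 * affRefl n 1) := by
  intro h
  have h1 := Equiv.congr_fun h 0
  have e : affRefl n 1 0 = 1 := by simpa using affRefl_pred_self n 1
  rw [affRefl_mul_mul_zero hn, Equiv.Perm.mul_apply, Equiv.Perm.mul_apply, affRefl_self,
    show (0 - 1 : ℤ) = -1 - 0 by ring, (isAffSigned_affRefl n 1).neg, e,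
    (isAffSigned_affRefl n 0).neg, affRefl_fixed (by omega) (by omega) (by omega)
    (by omega) (by omega) (by omega) (by omega) (by omega)] at h1
  omega

theorem affRefl_mul_mul_last (hn : 2 ≤ n) :
    (affRefl n (n - 1) * (affRefl n n * affRefl n (n - 1))) (n - 1) = n - 1 := by
  rw [Equiv.Perm.mul_apply, Equiv.Perm.mul_apply, affRefl_self,
    affRefl_fixed (i := n) (k := n - 1 - 1) (by omega) (by omega) (by omega) (by omega) (by omega)
      (by omega) (by omega) (by omega), affRefl_pred_self]

theorem affRefl_braid_four_last (hn : 2 ≤ n) :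
    affRefl n n * (affRefl n (n - 1) * (affRefl n n * affRefl n (n - 1))) =
      affRefl n (n - 1) * (affRefl n n * affRefl n (n - 1)) * affRefl n n := by
  have hw := (isAffSigned_affRefl n (n - 1)).mul
    ((isAffSigned_affRefl n n).mul (isAffSigned_affRefl n (n - 1)))
  have h0 := affRefl_mul_mul_last hn
  refine hw.affRefl_mul_of_up (affUp_self n n) h0 ?_
  have h1 := hw.neg (n - 1)
  have h2 := hw.add (-1 - (n - 1))
  rw [h1, h0] at h2
  rw [show (n : ℤ) - 1 + 1 = -1 - (n - 1) + 2 * n by ring, h2]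
  ring

theorem affRefl_mul_mul_ne_last (hn : 2 ≤ n) :
    affRefl n (n - 1) * (affRefl n n * affRefl n (n - 1)) ≠
      affRefl n n * (affRefl n (n - 1) * affRefl n n) := by
  intro h
  have h1 := Equiv.congr_fun h (n - 1)
  rw [affRefl_mul_mul_last hn, Equiv.Perm.mul_apply, Equiv.Perm.mul_apply, affRefl_pred_self] at h1
  have h2 := congrArg (affRefl n n) h1
  rw [affRefl_affRefl, affRefl_pred_self] at h2
  have h3 := (isAffSigned_affRefl n (n - 1)).add (-1 - (n - 1))
  rw [(isAffSigned_affRefl n (n - 1)).neg, affRefl_self,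
    show -1 - ((n : ℤ) - 1) + 2 * n = n by ring, ← h2] at h3
  omega

end Braid

theorem coxeterMatrixCTilde_apply (n : ℕ) (i j : Fin (n + 1)) : coxeterMatrixCTilde n i j =
    if i = j then 1
    else if (i : ℕ) + 1 = j ∨ (j : ℕ) + 1 = i then
      (if (i : ℕ) = 0 ∨ (j : ℕ) = 0 ∨ (i : ℕ) = n ∨ (j : ℕ) = n then 4 else 3)
    else 2 := rfl

theorem coxeterMatrixCTilde_ne_zero (n : ℕ) (i j : Fin (n + 1)) :
    coxeterMatrixCTilde n i j ≠ 0 := by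
  rw [coxeterMatrixCTilde_apply]
  split_ifs <;> decide

theorem hasBraidOrders_affGen {n : ℕ} (hn : 2 ≤ n) :
    HasBraidOrders (affGen n) (coxeterMatrixCTilde n) := by
  have main : ∀ i j : Fin (n + 1), i < j →
      altProd (affGen n i) (affGen n j) (coxeterMatrixCTilde n i j) =
        altProd (affGen n j) (affGen n i) (coxeterMatrixCTilde n i j) ∧
      ∀ k, 0 < k → k < coxeterMatrixCTilde n i j →
        altProd (affGen n i) (affGen n j) k ≠ altProd (affGen n j) (affGen n i) k := by
    intro i j hij
    have hne : (i : ℕ) < j := hij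
    have hjn : (j : ℕ) < n + 1 := j.2
    have h1 : altProd (affGen n i) (affGen n j) 1 ≠ altProd (affGen n j) (affGen n i) 1 := by
      intro e
      simp only [altProd_succ, altProd_zero, mul_one] at e
      exact affRefl_ne (n := n) (i := (i : ℕ)) (j := (j : ℕ)) (by omega) (by omega) (by omega)
        (congrArg Subtype.val e)
    rw [coxeterMatrixCTilde_apply, if_neg hij.ne]
    by_cases hadj : (i : ℕ) + 1 = j ∨ (j : ℕ) + 1 = i
    · have hj : ((j : ℕ) : ℤ) = (i : ℕ) + 1 := by omega
      have h2 : altProd (affGen n i) (affGen n j) 2 ≠ altProd (affGen n j) (affGen n i) 2 := by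
        intro e
        simp only [altProd_succ, altProd_zero, mul_one] at e
        have e' := congrArg Subtype.val e
        simp only [Subgroup.coe_mul, coe_affGen, hj] at e'
        exact affRefl_mul_ne hn (by omega) (by omega) e'
      rw [if_pos hadj]
      split_ifs with hend
      · have h3 : altProd (affGen n i) (affGen n j) 3 ≠ altProd (affGen n j) (affGen n i) 3 ∧
            altProd (affGen n i) (affGen n j) 4 = altProd (affGen n j) (affGen n i) 4 := by
          simp only [altProd_succ, altProd_zero, mul_one, ne_eq, Subtype.ext_iff,
            Subgroup.coe_mul, coe_affGen]
          by_cases hi : (i : ℕ) = 0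
          · rw [hj, hi, Nat.cast_zero, zero_add]
            refine ⟨affRefl_mul_mul_ne_zero hn, ?_⟩
            rw [affRefl_braid_four_zero hn]
            simp only [mul_assoc]
          · have hi' : ((i : ℕ) : ℤ) = n - 1 := by omega
            rw [hj, hi', sub_add_cancel]
            refine ⟨affRefl_mul_mul_ne_last hn, ?_⟩
            rw [affRefl_braid_four_last hn]
            simp only [mul_assoc]
        refine ⟨h3.2, fun k hk hk' ↦ ?_⟩
        interval_cases k
        exacts [h1, h2, h3.1]
      · refine ⟨?_, fun k hk hk' ↦ ?_⟩
        · simp only [altProd_succ, altProd_zero, mul_one, Subtype.ext_iff, Subgroup.coe_mul,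
            coe_affGen, hj]
          rw [affRefl_braid_three (by omega) (by omega), mul_assoc]
        · interval_cases k
          exacts [h1, h2]
    · rw [if_neg hadj]
      refine ⟨?_, fun k hk hk' ↦ ?_⟩
      · simp only [altProd_succ, altProd_zero, mul_one, Subtype.ext_iff, Subgroup.coe_mul,
          coe_affGen]
        exact affRefl_comm (by omega) (by omega) (by omega)
      · interval_cases k
        exact h1
  refine ⟨coxeterMatrixCTilde_ne_zero n, fun i j ↦ ?_, fun i j k hk hk' ↦ ?_⟩
  · rcases lt_trichotomy i j with hij | rfl | hij
    · exact (main i j hij).1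
    · rfl
    · rw [(coxeterMatrixCTilde n).symmetric]
      exact (main j i hij).1.symm
  · rcases lt_trichotomy i j with hij | rfl | hij
    · exact (main i j hij).2 k hk hk'
    · rw [(coxeterMatrixCTilde n).diagonal] at hk'
      omega
    · rw [(coxeterMatrixCTilde n).symmetric] at hk'
      exact ((main j i hij).2 k hk hk').symm

/-! ### Comparison of the affine Weyl groups for `n` and `n + 1`. -/

/-- The injection of `ℤ` into `ℤ` along which `affGroup n` embeds into `affGroup (n + 1)`. -/
def affEmb (n : ℕ) (k : ℤ) : ℤ := k + 2 * ((k + n) / (2 * n))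

theorem affEmb_injective {n : ℕ} (hn : 1 ≤ n) : Function.Injective (affEmb n) := by
  refine StrictMono.injective fun k l hkl ↦ ?_
  have : (k + n) / (2 * n) ≤ (l + n) / (2 * n) := Int.ediv_le_ediv (by omega) (by omega)
  simp only [affEmb]
  omega

theorem affEmb_add {n : ℕ} (hn : 1 ≤ n) (k m : ℤ) :
    affEmb n (k + 2 * n * m) = affEmb n k + 2 * ((n + 1 : ℕ) : ℤ) * m := by
  have e : k + 2 * n * m + n = k + n + 2 * n * m := by ring
  rw [affEmb, affEmb, e, Int.add_mul_ediv_left _ _ (by omega)]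
  push_cast
  ring

theorem affEmb_of_lt {n : ℕ} {k : ℤ} (h1 : -n ≤ k) (h2 : k < n) : affEmb n k = k := by
  rw [affEmb, Int.ediv_eq_zero_of_lt (by omega) (by omega), mul_zero, add_zero]

/-- `affEmb n` is the identity on `[-n, n)`, turns the period `2n` into `2n + 2` (two residues are
left out) and commutes with `k ↦ -1 - k`. A fundamental domain for both symmetries is therefore
enough. -/
theorem affEmb_intertwine {n : ℕ} (hn : 1 ≤ n) {w w' : Equiv.Perm ℤ} (hw : IsAffSigned n w)
    (hw' : IsAffSigned (n + 1) w') (h : ∀ k : ℤ, 0 ≤ k → k < n → w' k = affEmb n (w k)) (k : ℤ) :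
    w' (affEmb n k) = affEmb n (w k) := by
  have hneg : ∀ k, affEmb n (-1 - k) = -1 - affEmb n k := fun k ↦ by
    have hd := Int.emod_add_mul_ediv (k + n) (2 * n)
    have h1 := Int.emod_nonneg (k + n) (b := 2 * n) (by omega)
    have h2 := Int.emod_lt_of_pos (k + n) (b := 2 * n) (by omega)
    set r := (k + n) % (2 * n) with hr
    set m := (k + n) / (2 * n)
    have e : k = (r - n) + 2 * n * m := by linarith
    have e' : -1 - k = (-1 - (r - n)) + 2 * n * (-m) := by linarith
    rw [e', affEmb_add hn, affEmb_of_lt (by omega) (by omega), e, affEmb_add hn,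
      affEmb_of_lt (by omega) (by omega)]
    ring
  have main : ∀ k : ℤ, -n ≤ k → k < n → w' (affEmb n k) = affEmb n (w k) := fun k h1 h2 ↦ by
    rw [affEmb_of_lt h1 h2]
    rcases le_or_gt 0 k with hk | hk
    · exact h k hk h2
    · have := h (-1 - k) (by omega) (by omega)
      rw [hw.neg, hw'.neg, hneg] at this
      linarith
  have hd := Int.emod_add_mul_ediv (k + n) (2 * n)
  have h1 := Int.emod_nonneg (k + n) (b := 2 * n) (by omega)
  have h2 := Int.emod_lt_of_pos (k + n) (b := 2 * n) (by omega)
  have e : k = ((k + n) % (2 * n) - n) + 2 * n * ((k + n) / (2 * n)) := by linarith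
  rw [e, affEmb_add hn, hw'.add_mul, hw.add_mul, affEmb_add hn, main _ (by omega) (by omega)]

/-- The images in `affGroup (n + 1)` of the generators of `affGroup n`. -/
def affTower (n : ℕ) (i : Fin (n + 1)) : affGroup (n + 1) :=
  if i = Fin.last n then
    affGen (n + 1) i.castSucc * affGen (n + 1) (Fin.last (n + 1)) * affGen (n + 1) i.castSucc
  else affGen (n + 1) i.castSucc

theorem affTower_apply_affEmb {n : ℕ} (hn : 2 ≤ n) (i : Fin (n + 1)) (k : ℤ) :
    (affTower n i : Equiv.Perm ℤ) (affEmb n k) = affEmb n ((affGen n i : Equiv.Perm ℤ) k) := by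
  refine affEmb_intertwine (by omega) (isAffSigned_of_mem (affGen n i).2)
    (isAffSigned_of_mem (affTower n i).2) (fun k hk hkn ↦ ?_) k
  rw [affTower]
  split_ifs with hi
  · subst hi
    simp only [Subgroup.coe_mul, coe_affGen, Fin.val_castSucc, Fin.val_last, Equiv.Perm.mul_apply]
    -- The only point of the domain that moves: `n - 1 ↦ n ↦ n + 1 ↦ n + 2`, which jumps over the
    -- omitted values `n` and `n + 1` and lands on `affEmb n n`.
    by_cases hk1 : k = n - 1
    · subst hk1
      have e := affRefl_pred_self (n + 1) ((n + 1 : ℕ) : ℤ)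
      rw [show ((n + 1 : ℕ) : ℤ) - 1 = n by push_cast; ring] at e
      have e2 : affRefl (n + 1) n ((n + 1 : ℕ) : ℤ) = n + 2 := by
        have h1 := (isAffSigned_affRefl (n + 1) n).add (-1 - n)
        rw [(isAffSigned_affRefl (n + 1) n).neg, affRefl_self] at h1
        rw [show ((n + 1 : ℕ) : ℤ) = -1 - n + 2 * ((n + 1 : ℕ) : ℤ) by push_cast; ring, h1]
        push_cast
        ring
      have e3 : affEmb n n = n + 2 := by
        have := affEmb_add (n := n) (by omega) (-n) 1
        rw [affEmb_of_lt le_rfl (by omega)] at this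
        rw [show (n : ℤ) = -n + 2 * n * 1 by ring, this]
        push_cast
        ring
      rw [affRefl_pred_self, affRefl_pred_self, e, e2, e3]
    · have e1 : affRefl n n k = k := affRefl_fixed (by omega) (by omega)
        (by omega) (by omega) (by omega) (by omega) (by omega) (by omega)
      have e2 : affRefl (n + 1) n k = k := affRefl_fixed (by omega) (by omega)
        (by omega) (by omega) (by omega) (by omega) (by omega) (by omega)
      have e3 : affRefl (n + 1) (n + 1 : ℕ) k = k := affRefl_fixed (by omega) (by omega)
        (by omega) (by omega) (by omega) (by omega) (by omega) (by omega)
      rw [e1, e2, e3, e2, affEmb_of_lt (by omega) (by omega)]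
  · have hlt : (i : ℕ) < n := by
      have := i.2
      have : (i : ℕ) ≠ n := fun h ↦ hi (Fin.ext h)
      omega
    simp only [coe_affGen, Fin.val_castSucc]
    by_cases h1 : k = (i : ℕ) - 1
    · rw [h1, affRefl_pred_self, affRefl_pred_self, affEmb_of_lt (by omega) (by omega)]
    · by_cases h2 : k = (i : ℕ)
      · rw [h2, affRefl_self, affRefl_self, affEmb_of_lt (by omega) (by omega)]
      · rw [affRefl_fixed (by omega) (by omega) (by omega) (by omega)
          (by omega) (by omega) (by omega) (by omega), affRefl_fixed (by omega) (by omega)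
          (by omega) (by omega) (by omega) (by omega) (by omega) (by omega),
          affEmb_of_lt (by omega) (by omega)]

theorem prod_affGen_eq_of_prod_affTower_eq {n : ℕ} (hn : 2 ≤ n) {L L' : List (Fin (n + 1))}
    (e : (L.map (affTower n)).prod = (L'.map (affTower n)).prod) :
    (L.map (affGen n)).prod = (L'.map (affGen n)).prod := by
  have key : ∀ (L : List (Fin (n + 1))) (k : ℤ),
      ((L.map (affTower n)).prod : Equiv.Perm ℤ) (affEmb n k) =
        affEmb n (((L.map (affGen n)).prod : Equiv.Perm ℤ) k) := fun L k ↦ by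
    induction L generalizing k with
    | nil => rfl
    | cons i L ih =>
      simp only [List.map_cons, List.prod_cons, Subgroup.coe_mul, Equiv.Perm.mul_apply]
      rw [ih, affTower_apply_affEmb hn]
  apply Subtype.ext
  ext k
  apply affEmb_injective (n := n) (by omega)
  rw [← key, ← key, e]

/-! ### Existence and uniqueness of the tower homomorphism. -/

section Tower

variable {K : Type*} [CommRing K] (q : Kˣ)

theorem heckeUnit_braid {B : Type*} (M : CoxeterMatrix B) (i j : B) (hij : M i j ≠ 0) :
    altProd (heckeUnit M q i) (heckeUnit M q j) (M i j) =
      altProd (heckeUnit M q j) (heckeUnit M q i) (M i j) := by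
  apply Units.ext
  have := heckeGen_braid (M := M) (q : K) i j hij
  change Units.coeHom _ (altProd _ _ _) = Units.coeHom _ (altProd _ _ _)
  rw [map_altProd, map_altProd]
  exact this

theorem units_conj_sq {A : Type*} [Ring A] [Algebra K A] {r : K} (u x : Aˣ)
    (hx : (x : A) ^ 2 = algebraMap K A r + (r - 1) • (x : A)) :
    ((u * x * u⁻¹ : Aˣ) : A) ^ 2 = algebraMap K A r + (r - 1) • ((u * x * u⁻¹ : Aˣ) : A) := by
  have e : ((u * x * u⁻¹ : Aˣ) : A) ^ 2 = u * (x : A) ^ 2 * ↑u⁻¹ := by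
    rw [← Units.val_pow_eq_pow_val, conj_pow]; simp
  rw [e, hx, mul_add, add_mul, ← Algebra.commutes, mul_assoc, Units.mul_inv, mul_one]
  simp

/-- If `a`, `b` satisfy the braid relation of length `3`, `b`, `t` the one of length `4`, and `a`
commutes with `t`, then `a` and `b t b⁻¹` satisfy the braid relation of length `4`. -/
theorem altProd_conj_four {A : Type*} [Group A] {a b t : A} (h3 : altProd a b 3 = altProd b a 3)
    (h4 : altProd b t 4 = altProd t b 4) (h2 : altProd a t 2 = altProd t a 2) :
    altProd a (b * t * b⁻¹) 4 = altProd (b * t * b⁻¹) a 4 := by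
  simp only [altProd_succ, altProd_zero, mul_one] at h3 h2
  -- Conjugation by `b * a` takes the pair `(b, t)` to `(a, b * t * b⁻¹)`.
  have ha : MulAut.conj (b * a) b = a := by
    rw [MulAut.conj_apply, mul_inv_eq_iff_eq_mul, mul_assoc, ← h3]
  have ht : MulAut.conj (b * a) t = b * t * b⁻¹ := by
    rw [MulAut.conj_apply, mul_inv_rev, mul_assoc b a t, h2]; group
  have := congrArg (MulAut.conj (b * a)) h4
  rwa [map_altProd, map_altProd, ha, ht] at this

/-- The images of the generators of the Hecke algebra of type `C̃ₙ` in the one of type `C̃ₙ₊₁`. -/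
def towerGen (n : ℕ) (i : Fin (n + 1)) : (HeckeCTilde q (n + 1))ˣ :=
  if i = Fin.last n then
    gSigma q (n + 1) i * gT q (n + 1) * (gSigma q (n + 1) i)⁻¹
  else gSigma q (n + 1) i

theorem towerGen_sq (n : ℕ) (i : Fin (n + 1)) : (towerGen q n i : HeckeCTilde q (n + 1)) ^ 2 =
    algebraMap K _ (q : K) + ((q : K) - 1) • (towerGen q n i : HeckeCTilde q (n + 1)) := by
  rw [towerGen]
  split_ifs
  · exact units_conj_sq _ _ (heckeGen_sq _ _ _)
  · exact heckeGen_sq _ _ _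

theorem gSigma_braid (n : ℕ) (i j : Fin n) {m : ℕ}
    (hm : coxeterMatrixCTilde n i.castSucc j.castSucc = m) :
    altProd (gSigma q n i) (gSigma q n j) m = altProd (gSigma q n j) (gSigma q n i) m := by
  rw [← hm]
  exact heckeUnit_braid q _ _ _ (coxeterMatrixCTilde_ne_zero n _ _)

theorem gSigma_gT_braid (n : ℕ) (i : Fin n) {m : ℕ}
    (hm : coxeterMatrixCTilde n i.castSucc (Fin.last n) = m) :
    altProd (gSigma q n i) (gT q n) m = altProd (gT q n) (gSigma q n i) m := by
  rw [← hm]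
  exact heckeUnit_braid q _ _ _ (coxeterMatrixCTilde_ne_zero n _ _)

theorem towerGen_braid_of_lt {n : ℕ} (hn : 2 ≤ n) {i j : Fin (n + 1)} (hij : i < j) :
    altProd (towerGen q n i) (towerGen q n j) (coxeterMatrixCTilde n i j) =
      altProd (towerGen q n j) (towerGen q n i) (coxeterMatrixCTilde n i j) := by
  have hlt : (i : ℕ) < j := hij
  have hjn : (j : ℕ) < n + 1 := j.2
  have hi : i ≠ Fin.last n := fun h ↦ by rw [h, Fin.val_last] at hlt; omega
  rw [towerGen, towerGen, if_neg hi]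
  split_ifs with hj
  · subst hj
    rw [Fin.val_last] at hlt
    by_cases hin : (i : ℕ) + 1 = n
    · have e : coxeterMatrixCTilde n i (Fin.last n) = 4 := by
        simp [coxeterMatrixCTilde_apply, hij.ne, hin]
      rw [e]
      -- Here `a`, `b`, `t` are `σ_{n-1}`, `σ_n`, `t_{n+1}`. As `n ≥ 2`, the edge from `σ_{n-1}` to
      -- `σ_n` is not extreme in `C̃ₙ₊₁` and has label 3.
      refine altProd_conj_four (gSigma_braid q _ _ _ ?_) (gSigma_gT_braid q _ _ ?_)
        (gSigma_gT_braid q _ _ ?_)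
      all_goals
        simp only [coxeterMatrixCTilde_apply, Fin.ext_iff, Fin.val_castSucc, Fin.val_last]
        grind
    · have e : coxeterMatrixCTilde n i (Fin.last n) = 2 := by
        simp only [coxeterMatrixCTilde_apply, Fin.ext_iff, Fin.val_last]
        grind
      have h1 := gSigma_braid q (n + 1) i (Fin.last n) (m := 2) (by
        simp only [coxeterMatrixCTilde_apply, Fin.ext_iff, Fin.val_castSucc, Fin.val_last]
        grind)
      have h2 := gSigma_gT_braid q (n + 1) i (m := 2) (by
        simp only [coxeterMatrixCTilde_apply, Fin.ext_iff, Fin.val_castSucc, Fin.val_last]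
        grind)
      rw [e]
      simp only [altProd_succ, altProd_zero, mul_one] at h1 h2 ⊢
      have h1' : Commute (gSigma q (n + 1) i) (gSigma q (n + 1) (Fin.last n)) := h1
      have h2' : Commute (gSigma q (n + 1) i) (gT q (n + 1)) := h2
      exact ((h1'.mul_right h2').mul_right h1'.inv_right).eq
  · refine gSigma_braid q _ _ _ ?_
    have : (j : ℕ) ≠ n := fun h ↦ hj (Fin.ext h)
    simp only [coxeterMatrixCTilde_apply, Fin.ext_iff, Fin.val_castSucc]
    grind

theorem towerGen_braid {n : ℕ} (hn : 2 ≤ n) (i j : Fin (n + 1)) :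
    altProd (towerGen q n i) (towerGen q n j) (coxeterMatrixCTilde n i j) =
      altProd (towerGen q n j) (towerGen q n i) (coxeterMatrixCTilde n i j) := by
  rcases lt_trichotomy i j with hij | rfl | hij
  · exact towerGen_braid_of_lt q hn hij
  · rfl
  · rw [(coxeterMatrixCTilde n).symmetric]
    exact (towerGen_braid_of_lt q hn hij).symm

/-- The homomorphism from the Hecke algebra of type `C̃ₙ` to the one of type `C̃ₙ₊₁`. -/
def towerMap {n : ℕ} (hn : 2 ≤ n) : HeckeCTilde q n →ₐ[K] HeckeCTilde q (n + 1) :=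
  RingQuot.liftAlgHom K ⟨FreeAlgebra.lift K fun i ↦ (towerGen q n i : HeckeCTilde q (n + 1)), by
    rintro _ _ (⟨i⟩ | ⟨i, j, -⟩)
    · simpa using towerGen_sq q n i
    · have := congrArg (Units.coeHom _) (towerGen_braid q hn i j)
      rw [map_altProd, map_altProd] at this
      simp only [map_altProd, FreeAlgebra.lift_ι_apply]
      exact this⟩

theorem isTowerMap_iff {n : ℕ} (R : HeckeCTilde q n →ₐ[K] HeckeCTilde q (n + 1)) :
    IsTowerMap q n R ↔ ∀ i, R (heckeGen _ (q : K) i) = towerGen q n i := by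
  have h1 : towerGen q n (Fin.last n) = gSigma q (n + 1) (Fin.last n) * gT q (n + 1) *
      (gSigma q (n + 1) (Fin.last n))⁻¹ := if_pos rfl
  have h2 : ∀ i : Fin n, towerGen q n i.castSucc = gSigma q (n + 1) i.castSucc := fun i ↦
    if_neg (Fin.castSucc_lt_last i).ne
  rw [Fin.forall_fin_succ', h1]
  simp only [h2]
  rfl

theorem isTowerMap_towerMap {n : ℕ} (hn : 2 ≤ n) : IsTowerMap q n (towerMap q hn) := by
  rw [isTowerMap_iff]
  intro i
  simp [towerMap, heckeGen]

theorem IsTowerMap.eq {n : ℕ} {R R' : HeckeCTilde q n →ₐ[K] HeckeCTilde q (n + 1)}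
    (hR : IsTowerMap q n R) (hR' : IsTowerMap q n R') : R = R' := by
  rw [isTowerMap_iff] at hR hR'
  exact heckeAlgebra_algHom_ext fun i ↦ (hR i).trans (hR' i).symm

end Tower

/-! ### Injectivity by specialization at `q = 1`. -/

/-- Finitely supported functions on `X` which specialize to distinct basis vectors are linearly
independent. -/
theorem linearIndependent_of_mapRange {K k ι X : Type*} [CommRing K] [IsDomain K] [CommRing k]
    [Nontrivial k] (ev : K →+* k) (F : ι → X →₀ K) {φ : ι → X} (hφ : Function.Injective φ)
    (hF : ∀ i, (F i).mapRange ev (map_zero ev) = Finsupp.single (φ i) 1) :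
    LinearIndependent K F := by
  classical
  rw [linearIndependent_iff']
  intro t g hg i hi
  -- The minor on the coordinates `φ j` specializes to the identity matrix, so its determinant is
  -- nonzero in the domain `K`.
  let A : Matrix t t K := Matrix.of fun i j ↦ F i (φ j)
  have hA : ev.mapMatrix A = 1 := by
    ext i j
    have := DFunLike.congr_fun (hF i) (φ j)
    rw [Finsupp.mapRange_apply] at this
    simp only [RingHom.mapMatrix_apply, Matrix.map_apply, A, Matrix.of_apply, this,
      Finsupp.single_apply, hφ.eq_iff, Matrix.one_apply, Subtype.ext_iff]
  have hdet : A.det ≠ 0 := fun h ↦ by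
    have h1 := ev.map_det A
    rw [hA, Matrix.det_one, h, map_zero] at h1
    exact zero_ne_one h1
  have hv : Matrix.vecMul (fun i : t ↦ g i) A = 0 := by
    ext j
    have := DFunLike.congr_fun hg (φ j)
    rw [Finsupp.finsetSum_apply, ← Finset.sum_coe_sort] at this
    simpa [Matrix.vecMul, dotProduct, A] using this
  exact congrFun (Matrix.eq_zero_of_vecMul_eq_zero hdet hv) ⟨i, hi⟩

section Specialization

variable {G B : Type*} [Group G] {s : B → G} {N : B → G → Prop} {K k : Type*} [CommRing K]
  [CommRing k] (q : Kˣ) (ev : K →+* k)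

/-- If `q` specializes to `1`, the operators `leftOp` specialize to left multiplications. -/
theorem mapRange_leftOp (hq : ev q = 1) (i : B) (v : G →₀ K) :
    (leftOp s N q i v).mapRange ev (map_zero ev) =
      (v.mapRange ev (map_zero ev)).mapDomain (s i * ·) := by
  have hsmul : ∀ (a : K) (u : G →₀ K), (a • u).mapRange ev (map_zero ev) =
      ev a • u.mapRange ev (map_zero ev) := fun a u ↦ by ext; simp
  induction v using Finsupp.induction_linear with
  | zero => simp
  | add u v hu hv =>
    rw [map_add, Finsupp.mapRange_add (map_add ev), hu, hv, Finsupp.mapRange_add (map_add ev),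
      Finsupp.mapDomain_add]
  | single w a =>
    have e : Finsupp.single w a = a • Finsupp.single w (1 : K) := by simp
    rw [e, map_smul, hsmul, hsmul, Finsupp.mapDomain_smul]
    congr 1
    by_cases hN : N i w
    · rw [leftOp_of_neg q hN, Finsupp.mapRange_add (map_add ev), hsmul, hsmul, map_sub, hq]
      simp
    · rw [leftOp_of_not_neg q hN]
      simp

end Specialization

section Injectivity

variable {K k : Type*} [CommRing K] [CommRing k] {q : Kˣ} (ev : K →+* k)

theorem mapRange_regularRep_towerGen (hq : ev q = 1) {n : ℕ} (hn : 2 ≤ n) (i : Fin (n + 1))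
    (v : affGroup (n + 1) →₀ K) :
    ((affExchangeSystem (n + 1)).regularRep q (hasBraidOrders_affGen (by omega))
      (towerGen q n i) v).mapRange ev (map_zero ev) =
      (v.mapRange ev (map_zero ev)).mapDomain (affTower n i * ·) := by
  set ρ := (affExchangeSystem (n + 1)).regularRep q (hasBraidOrders_affGen (n := n + 1) (by omega))
  have hgen : ∀ (j : Fin (n + 2)) (v : affGroup (n + 1) →₀ K),
      (ρ (heckeUnit (coxeterMatrixCTilde (n + 1)) q j) v).mapRange ev (map_zero ev) =
        (v.mapRange ev (map_zero ev)).mapDomain (affGen (n + 1) j * ·) := fun j v ↦ by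
    rw [← mapRange_leftOp q ev hq (N := AffNeg (n + 1)) j v]
    exact congrArg (fun f : Module.End K _ ↦ (f v).mapRange ev (map_zero ev))
      ((affExchangeSystem (n + 1)).regularRep_heckeGen q _ j)
  -- At `q = 1` a generator and its inverse act alike, since `affGen (n + 1) j` is an involution.
  have hinv : ∀ (j : Fin (n + 2)) (v : affGroup (n + 1) →₀ K),
      (ρ (↑(heckeUnit (coxeterMatrixCTilde (n + 1)) q j)⁻¹) v).mapRange ev (map_zero ev) =
        (v.mapRange ev (map_zero ev)).mapDomain (affGen (n + 1) j * ·) := fun j v ↦ by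
    have h1 := hgen j (ρ (↑(heckeUnit (coxeterMatrixCTilde (n + 1)) q j)⁻¹) v)
    rw [← Module.End.mul_apply, ← map_mul, Units.mul_inv, map_one, Module.End.one_apply] at h1
    rw [h1, ← Finsupp.mapDomain_comp]
    have e : ((affGen (n + 1) j * ·) ∘ (affGen (n + 1) j * ·)) = id := funext fun w ↦
      (affExchangeSystem (n + 1)).mul_cancel j w
    rw [e, Finsupp.mapDomain_id]
  rw [towerGen, affTower]
  split_ifs with hi
  · rw [Units.val_mul, Units.val_mul, map_mul, map_mul, Module.End.mul_apply, Module.End.mul_apply,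
      gSigma, gT, hgen, hgen, hinv, ← Finsupp.mapDomain_comp, ← Finsupp.mapDomain_comp]
    congr 1
  · exact hgen _ v

theorem IsTowerMap.injective [IsDomain K] [Nontrivial k] (hq : ev q = 1) {n : ℕ} (hn : 2 ≤ n)
    {R : HeckeCTilde q n →ₐ[K] HeckeCTilde q (n + 1)} (hR : IsTowerMap q n R) :
    Function.Injective R := by
  rw [isTowerMap_iff] at hR
  let ρ := (affExchangeSystem (n + 1)).regularRep q (hasBraidOrders_affGen (n := n + 1) (by omega))
  let Φ : HeckeCTilde q n →ₗ[K] (affGroup (n + 1) →₀ K) :=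
    (LinearMap.applyₗ (Finsupp.single 1 1)).comp (ρ.comp R).toLinearMap
  have hΦ : ∀ x, Φ x = ρ (R x) (Finsupp.single 1 1) := fun x ↦ rfl
  -- The same choice of reduced words as in `basisElt`, so that the two agree definitionally.
  let L : affGroup n → List (Fin (n + 1)) := fun w ↦
    ((affExchangeSystem n).exists_reduced w).choose
  have hL : ∀ w, ((L w).map (affGen n)).prod = w := fun w ↦
    ((affExchangeSystem n).exists_reduced w).choose_spec.1
  have hF : ∀ w, (Φ ((affExchangeSystem n).basisElt (coxeterMatrixCTilde n) (q : K) w)).mapRange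
      ev (map_zero ev) = Finsupp.single ((L w).map (affTower n)).prod 1 := by
    intro w
    change (Φ ((L w).map (heckeGen _ _)).prod).mapRange ev (map_zero ev) = _
    rw [hΦ]
    induction L w with
    | nil => simp
    | cons i l ih =>
      rw [List.map_cons, List.prod_cons, map_mul, map_mul, Module.End.mul_apply, hR,
        mapRange_regularRep_towerGen ev hq hn, ih, Finsupp.mapDomain_single, List.map_cons,
        List.prod_cons]
  have hφ : Function.Injective fun w ↦ ((L w).map (affTower n)).prod := fun w w' e ↦ by
    rw [← hL w, ← hL w']
    exact prod_affGen_eq_of_prod_affTower_eq hn e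
  have hli := linearIndependent_of_mapRange ev _ hφ hF
  rw [injective_iff_map_eq_zero]
  intro x hx
  have hspan := (affExchangeSystem n).span_basisElt (hasBraidOrders_affGen hn) (q : K)
  obtain ⟨c, rfl⟩ := Finsupp.mem_span_range_iff_exists_finsupp.1
    (show x ∈ Submodule.span K _ by rw [hspan]; exact Submodule.mem_top)
  have h0 := hΦ (c.sum fun w a ↦ a • (affExchangeSystem n).basisElt (coxeterMatrixCTilde n)
    (q : K) w)
  rw [hx, map_zero, LinearMap.zero_apply, map_finsuppSum] at h0
  simp only [map_smul] at h0
  rw [linearIndependent_iff.1 hli c h0, Finsupp.sum_zero_index]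

end Injectivity

end

theorem proposition3p3 (n : ℕ) (hn : 2 ≤ n) :
    (∃! R : HeckeCTilde laurentQ n →ₐ[ℚ[T;T⁻¹]] HeckeCTilde laurentQ (n + 1),
      IsTowerMap laurentQ n R) ∧
    ∀ R : HeckeCTilde laurentQ n →ₐ[ℚ[T;T⁻¹]] HeckeCTilde laurentQ (n + 1),
      IsTowerMap laurentQ n R → Function.Injective R := by
  refine ⟨⟨towerMap laurentQ hn, isTowerMap_towerMap laurentQ hn, fun R hR ↦
    hR.eq laurentQ (isTowerMap_towerMap laurentQ hn)⟩, fun R hR ↦ ?_⟩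
  -- The specialization is evaluation of Laurent polynomials at `q = 1`.
  refine hR.injective (LaurentPolynomial.eval₂ (RingHom.id ℚ) (1 : ℚˣ)) ?_ hn
  simp [laurentQ]
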